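/- Let $d\ge 1$, $\Theta=\{\eta\in\mathbb R^d: |\eta|=1,\ \eta_1\ge 0\}$, and let $(X_i,Y_i)$, $i\ge 1$, be i.i.d. copies of $(X,Y)\in\mathbb R^d\times\mathbb R$ with $$Y=m_0(\theta_0^\top X)+\epsilon,\qquad \mathbb E(\epsilon\mid X)=0\ \text{a.s.},\qquad \theta_0\in\Theta .$$ Let $P_X$ be the law of $X$, $\chi$ its support, and $D=\{\theta^\top x: x\in\chi,\ \theta\in\Theta\}$. For $L\ge 0$ let $\mathcal M_L$ be the class of convex functions $m:D\to\mathbb R$ that are Lipschitz on $D$ with constant $L$. (If $D$ is not an interval, which can happen only for $d=1$, convexity on $D$ means that $m(as+bt)\le a\,m(s)+b\,m(t)$ whenever $a,b\ge 0$, $a+b=1$, and $s$, $t$, $as+bt\in D$.) Assume: (A1) $\chi$ is compact, and $\sup_{x\in\chi}|x|\le T$; (A2) there is $K_1>0$ with $K_1\,\mathbb E[\exp(\epsilon^2/K_1)-1\mid X]\le 1$ a.s.; (A3) the matrix $\mathbb E[XX^\top\{m_0'(\theta_0^\top X)\}^2]$ is nonsingular, where $m_0'$ is the right derivative of $m_0$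 on $D$ (nondecreasing, bounded in absolute value by $L_0$; at points of $D$ that are not limits of points of $D$ from the right, any values that respect these two properties are allowed); (A4) $\mathrm{Var}(X)$ is positive definite; (L1) $m_0$ is convex on $D$, bounded in absolute value by some $M_0\ge 1$ on $D$, and Lipschitz on $D$ with constant $L_0$. Let $L\ge L_0$, and for every $n\ge1$ let the Lipschitz constrained least squares estimator (LLSE) $(\check m_n,\check\theta_n)$ be any minimizer over $(m,\theta)\in\mathcal M_L\times\Theta$ of $$Q_n(m,\theta)=\frac1n\sum_{i=1}^n\{Y_i-m(\theta^\top X_i)\}^2 .$$ Then, with $\|g\|^2=\int g^2\,dP_X$, $$\|\check m_n\circ\check\theta_n-m_0\circ\theta_0\|=O_p(n^{-2/5}),$$ where $(m\circ\theta)(x)=m(\theta^\top x)$; that is, for every $\delta>0$ there is $C>0$ such that for all $n\ge 1$ the (outer) probability that $\|\check m_n\circ\check\theta_n-m_0\circ\theta_0\|>C\,n^{-2/5}$ is at most $\delta$. -/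

import Mathlib

open MeasureTheory ProbabilityTheory
open scoped NNReal ENNReal

noncomputable section

namespace CvxSIM

/-- The parameter set `Θ`: unit vectors of `ℝᵈ` whose first coordinate is nonnegative. -/
def indexSet (d : ℕ) [NeZero d] : Set (EuclideanSpace ℝ (Fin d)) :=
  {η | ‖η‖ = 1 ∧ 0 ≤ η 0}

/-- The set `D = {θᵀx : x ∈ χ, θ ∈ Θ}` of all index values. -/
def indexDomain {d : ℕ} [NeZero d] (χ : Set (EuclideanSpace ℝ (Fin d))) : Set ℝ :=
  {t | ∃ θ ∈ indexSet d, ∃ x ∈ χ, t = inner ℝ θ x}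

/-- `f` is convex on `S ⊆ ℝ`: Jensen's inequality holds whenever the three points involved lie
in `S`. If `S` is an interval this is the usual convexity (see `convexFunOn_iff`); the set `D`
is always an interval if `d ≥ 2`, but it need not be one if `d = 1`. -/
def ConvexFunOn (S : Set ℝ) (f : ℝ → ℝ) : Prop :=
  ∀ ⦃s : ℝ⦄, s ∈ S → ∀ ⦃t : ℝ⦄, t ∈ S → ∀ ⦃a b : ℝ⦄, 0 ≤ a → 0 ≤ b → a + b = 1 →
    a * s + b * t ∈ S → f (a * s + b * t) ≤ a * f s + b * f t

theorem convexFunOn_iff {S : Set ℝ} (hS : Convex ℝ S) (f : ℝ → ℝ) :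
    ConvexFunOn S f ↔ ConvexOn ℝ S f := by
  constructor
  · intro h
    refine ⟨hS, fun s hs t ht a b ha hb hab => ?_⟩
    have hmem := hS hs ht ha hb hab
    simp only [smul_eq_mul] at hmem ⊢
    exact h hs ht ha hb hab hmem
  · intro h s hs t ht a b ha hb hab _
    simpa only [smul_eq_mul] using h.2 hs ht ha hb hab

/-- The class `𝓜_L` of convex `L`-Lipschitz functions on `D`. Functions on `D` are represented by
functions on `ℝ`, whose values outside `D` are irrelevant. -/
def lipConvexClass (D : Set ℝ) (L : ℝ≥0) : Set (ℝ → ℝ) :=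
  {m | ConvexFunOn D m ∧ LipschitzOnWith L m D}

/-- `m'` is a right derivative on `D` of a convex `L`-Lipschitz function `m` on `D`: it is
nondecreasing, bounded by `L`, and equal to the right derivative of `m` at every point of `D` at
which the latter makes sense, that is, at the points that are limits of points of `D` from
the right (at all other points the last condition is void). -/
structure IsRightDerivOn (D : Set ℝ) (L : ℝ≥0) (m m' : ℝ → ℝ) : Prop where
  monotone : MonotoneOn m' D
  bound : ∀ t ∈ D, |m' t| ≤ L
  hasDeriv : ∀ t ∈ D, HasDerivWithinAt m (m' t) (D ∩ Set.Ici t) t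

/-- The least squares criterion `Qₙ(m, θ) = n⁻¹ ∑ᵢ (yᵢ - m(θᵀxᵢ))²`. -/
def leastSquares {d : ℕ} (n : ℕ) (x : ℕ → EuclideanSpace ℝ (Fin d)) (y : ℕ → ℝ)
    (m : ℝ → ℝ) (θ : EuclideanSpace ℝ (Fin d)) : ℝ :=
  (1 / (n : ℝ)) * ∑ i ∈ Finset.range n, (y i - m (inner ℝ θ (x i))) ^ 2

/-- `(m, θ)` is a Lipschitz constrained least squares estimate for the data `(xᵢ, yᵢ)`, `i < n`:
a minimizer of `Qₙ` over `𝓜_L × Θ`. -/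
structure IsLLSE {d : ℕ} [NeZero d] (D : Set ℝ) (L : ℝ≥0) (n : ℕ)
    (x : ℕ → EuclideanSpace ℝ (Fin d)) (y : ℕ → ℝ)
    (m : ℝ → ℝ) (θ : EuclideanSpace ℝ (Fin d)) : Prop where
  mem_class : m ∈ lipConvexClass D L
  mem_index : θ ∈ indexSet d
  minimizes : ∀ m₁ ∈ lipConvexClass D L, ∀ θ₁ ∈ indexSet d,
    leastSquares n x y m θ ≤ leastSquares n x y m₁ θ₁

/-- `E(ε | X) = 0` almost surely, for an integrable error `ε`. -/
def CondMeanZero {Ω : Type*} [MeasurableSpace Ω] {d : ℕ} (μ : Measure Ω)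
    (X : Ω → EuclideanSpace ℝ (Fin d)) (ε : Ω → ℝ) : Prop :=
  Integrable ε μ ∧ μ[ε | MeasurableSpace.comap X inferInstance] =ᵐ[μ] 0

/-- Uniform sub-Gaussianity: `K₁ E[exp(ε² / K₁) - 1 | X] ≤ 1` almost surely for some `K₁ > 0`.
(Integrability is implied by this bound; it has to be said because Lean's conditional expectation
of a non-integrable function is zero.) -/
def CondSubGaussian {Ω : Type*} [MeasurableSpace Ω] {d : ℕ} (μ : Measure Ω)
    (X : Ω → EuclideanSpace ℝ (Fin d)) (ε : Ω → ℝ) : Prop :=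
  ∃ K₁ : ℝ, 0 < K₁ ∧ Integrable (fun ω => Real.exp (ε ω ^ 2 / K₁) - 1) μ ∧
    ∀ᵐ ω ∂μ, K₁ * (μ[fun ω' => Real.exp (ε ω' ^ 2 / K₁) - 1 |
      MeasurableSpace.comap X inferInstance]) ω ≤ 1

/-- The matrix `E[X Xᵀ {m'(θᵀX)}²]`, where `X` has law `P`. -/
def weightedSecondMoment {d : ℕ} (P : Measure (EuclideanSpace ℝ (Fin d))) (m' : ℝ → ℝ)
    (θ : EuclideanSpace ℝ (Fin d)) : Matrix (Fin d) (Fin d) ℝ :=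
  Matrix.of fun i j => ∫ x, x i * x j * (m' (inner ℝ θ x)) ^ 2 ∂P

/-- The covariance matrix `Var(X)`, where `X` has law `P`. -/
def covMatrix {d : ℕ} (P : Measure (EuclideanSpace ℝ (Fin d))) : Matrix (Fin d) (Fin d) ℝ :=
  Matrix.of fun i j => covariance (fun x => x i) (fun x => x j) P

/-- The `L₂(P)` distance `‖m₁∘θ₁ - m₂∘θ₂‖`. -/
def compDist {d : ℕ} (P : Measure (EuclideanSpace ℝ (Fin d)))
    (m₁ : ℝ → ℝ) (θ₁ : EuclideanSpace ℝ (Fin d))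
    (m₂ : ℝ → ℝ) (θ₂ : EuclideanSpace ℝ (Fin d)) : ℝ≥0∞ :=
  eLpNorm (fun x => m₁ (inner ℝ θ₁ x) - m₂ (inner ℝ θ₂ x)) 2 P

/-- `Zₙ = O_p(rₙ)` (over `n ≥ 1`), for nonnegative `Zₙ`. On non-measurable sets `μ` is the outer
measure, so for non-measurable `Zₙ` this is boundedness in outer probability. -/
def IsBigOInProb {Ω : Type*} [MeasurableSpace Ω] (μ : Measure Ω)
    (Z : ℕ → Ω → ℝ≥0∞) (r : ℕ → ℝ) : Prop :=
  ∀ δ : ℝ, 0 < δ → ∃ C : ℝ, 0 < C ∧ ∀ n : ℕ, 1 ≤ n →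
    μ {ω | ENNReal.ofReal (C * r n) < Z n ω} ≤ ENNReal.ofReal δ

end CvxSIM

end

/-!
The estimator is compared with the truth through the basic inequality: if `f = m₀ ∘ θ₀`, `eᵢ = Yᵢ -
f(Xᵢ)`, and `g` is the fitted function, then `∑ᵢ (2 (g - f)(Xᵢ) eᵢ - (g - f)(Xᵢ)²) ≥ 0`. It is shown
that, with high probability, this fails for all `g` of the class with `‖g - f‖ > C n^(-2/5)`.

*Entropy.* A convex `L`-Lipschitz function on `D` extends to the line
(`ConvexFunOn.exists_extension`), so the class consists of ridge functions `x ↦ m(θᵀx)` with `m`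
convex and Lipschitz on the line. A convex `m` is recovered, without loss in the sup norm, from its
Moreau envelope, whose second differences at step `h` lie in `[0, h²]`. On a grid of step `1 / κ` the
envelope rounded to multiples of `κ⁻²` therefore has second differences in a set of four integers,
and is one of `exp (O(κ))` sequences. Thus the entropy at resolution `κ⁻²` is `O(κ)`, that is,
`log N(η) = O(η^(-1/2))` in the sup norm on balls, without logarithmic factors
(`exists_ridge_net`); quantizing `θ` only costs a polynomial factor.

*Fluctuations.* Conditional sub-Gaussianity gives the exponential moments of `a(X) e - b(X)`
(`integral_exp_le_of_condSubGaussian`). Put `n = q⁵`, so that `n^(-2/5) = q⁻²` and `n · n^(-4/5) = q`.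
Let `γ` be the approximation of `g` in the net of resolution `q⁻²`. Chaining down the nets of
resolution `(q 2ᵏ)⁻²` bounds `∑ᵢ (g - γ)(Xᵢ) eᵢ` by `O(q)` uniformly in `g`
(`SubGaussianSample.exists_chaining_event`). For the `exp (O(q))` functions `γ` of the net, the
quadratic drift beats the noise: `∑ᵢ (2 (γ - f)(Xᵢ) eᵢ - (γ - f)(Xᵢ)² / 2) < - n ‖γ - f‖² / 16` up to
probability `exp (-c n ‖γ - f‖²)` (`SubGaussianSample.offset_tail`), and a union bound applies once
`‖γ - f‖²` exceeds a large multiple of `q⁻⁴`. The two estimates contradict the basic inequality if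
`‖g - f‖` exceeds a large multiple of `q⁻²` (`SubGaussianSample.exists_rate_event`). Neither step
needs peeling, and the drift is controlled directly in `L²(P)`, so no comparison of the empirical
norm with the population norm is required.

*Boundedness.* The class is not bounded, as constants can be added. But the basic inequality forces
`|g - f|` to be at most twice the root mean square of the noise at some design point, and the Lipschitz
property propagates the bound (`exists_abs_le_of_risk_le`).
-/

namespace CvxSIM

/-! ### Subgradients and extension of convex Lipschitz functions on subsets of the line -/

theorem ConvexFunOn.slope_le {S : Set ℝ} {f : ℝ → ℝ} (hf : ConvexFunOn S f) {v u w : ℝ}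
    (hv : v ∈ S) (hu : u ∈ S) (hw : w ∈ S) (hvu : v < u) (huw : u < w) :
    (f u - f v) / (u - v) ≤ (f w - f u) / (w - u) := by
  have h1 : 0 < u - v := sub_pos.2 hvu
  have h2 : 0 < w - u := sub_pos.2 huw
  have h3 : 0 < w - v := by linarith
  have hmid : (w - u) / (w - v) * v + (u - v) / (w - v) * w = u := by
    field_simp; ring
  have h := hf hv hw (a := (w - u) / (w - v)) (b := (u - v) / (w - v)) (by positivity)
    (by positivity) (by field_simp; ring) (by rwa [hmid])
  rw [hmid, div_mul_eq_mul_div, div_mul_eq_mul_div, ← add_div, le_div_iff₀ h3] at h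
  rw [div_le_div_iff₀ h1 h2]
  nlinarith

theorem ConvexFunOn.exists_subgradient {S : Set ℝ} {f : ℝ → ℝ} {L : ℝ≥0} (hf : ConvexFunOn S f)
    (hL : LipschitzOnWith L f S) {u : ℝ} (hu : u ∈ S) :
    ∃ p : ℝ, |p| ≤ L ∧ ∀ v ∈ S, f u + p * (v - u) ≤ f v := by
  have hlip : ∀ v ∈ S, |f u - f v| ≤ L * |u - v| := fun v hv => by
    simpa [Real.dist_eq] using hL.dist_le_mul u hu v hv
  -- `-L` is inserted so that the supremum is over a nonempty set also at the left end of `S`.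
  set A : Set ℝ := insert (-(L : ℝ)) ((fun v => (f u - f v) / (u - v)) '' (S ∩ Set.Iio u)) with hA
  have hne : A.Nonempty := ⟨_, Set.mem_insert _ _⟩
  have hubL : (L : ℝ) ∈ upperBounds A := by
    rintro _ (rfl | ⟨v, ⟨hv, hvu⟩, rfl⟩)
    · linarith [L.coe_nonneg]
    · have h1 : 0 < u - v := sub_pos.2 hvu
      have := (abs_le.1 (hlip v hv)).2
      rw [abs_of_pos h1] at this
      exact (div_le_iff₀ h1).2 this
  have hubR : ∀ w ∈ S, u < w → (f w - f u) / (w - u) ∈ upperBounds A := by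
    rintro w hw huw _ (rfl | ⟨v, ⟨hv, hvu⟩, rfl⟩)
    · have h1 : 0 < w - u := sub_pos.2 huw
      have := (abs_le.1 (hlip w hw)).2
      rw [abs_sub_comm u w, abs_of_pos h1] at this
      rw [le_div_iff₀ h1]
      linarith
    · exact hf.slope_le hv hu hw hvu huw
  have hbdd : BddAbove A := ⟨_, hubL⟩
  refine ⟨sSup A, abs_le.2 ⟨le_csSup hbdd (Set.mem_insert _ _), csSup_le hne hubL⟩, ?_⟩
  intro v hv
  rcases lt_trichotomy v u with h | rfl | h
  · have h1 : 0 < u - v := sub_pos.2 h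
    have := le_csSup hbdd (Set.mem_insert_of_mem _ ⟨v, ⟨hv, h⟩, rfl⟩)
    rw [div_le_iff₀ h1] at this
    linarith
  · simp
  · have h1 : 0 < v - u := sub_pos.2 h
    have := csSup_le hne (hubR v hv h)
    rw [le_div_iff₀ h1] at this
    linarith

/-- A convex `L`-Lipschitz function on an arbitrary set of reals is the restriction of one on the
whole line: the supremum of its supporting affine functions. -/
theorem ConvexFunOn.exists_extension {S : Set ℝ} {f : ℝ → ℝ} {L : ℝ≥0} (hf : ConvexFunOn S f)
    (hL : LipschitzOnWith L f S) :
    ∃ g : ℝ → ℝ, ConvexOn ℝ Set.univ g ∧ LipschitzWith L g ∧ Set.EqOn g f S := by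
  rcases S.eq_empty_or_nonempty with rfl | ⟨u₀, hu₀⟩
  · exact ⟨fun _ => 0, convexOn_const 0 convex_univ, LipschitzWith.const' 0 |>.weaken zero_le,
      Set.eqOn_empty _ _⟩
  have hsub : ∀ u : S, ∃ p : ℝ, |p| ≤ L ∧ ∀ v ∈ S, f u + p * (v - u) ≤ f v :=
    fun u => hf.exists_subgradient hL u.2
  choose p hp hpf using hsub
  have : Nonempty S := ⟨⟨u₀, hu₀⟩⟩
  have hmul : ∀ (u : S) (z : ℝ), p u * z ≤ L * |z| := fun u z =>
    (le_abs_self _).trans (by rw [abs_mul]; gcongr; exact hp u)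
  have hbdd : ∀ x, BddAbove (Set.range fun u : S => f u + p u * (x - u)) := by
    intro x
    refine ⟨f u₀ + L * |x - u₀|, ?_⟩
    rintro _ ⟨u, rfl⟩
    have h1 := hpf u u₀ hu₀
    have h2 := hmul u (x - u₀)
    dsimp only
    linarith
  refine ⟨fun x => ⨆ u : S, f u + p u * (x - u), ⟨convex_univ, ?_⟩, ?_, ?_⟩
  · intro x _ y _ a b ha hb hab
    refine ciSup_le fun u => ?_
    have hx := mul_le_mul_of_nonneg_left (le_ciSup (hbdd x) u) ha
    have hy := mul_le_mul_of_nonneg_left (le_ciSup (hbdd y) u) hb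
    simp only [smul_eq_mul] at hx hy ⊢
    have hb' : b = 1 - a := by linarith
    subst hb'
    linarith
  · refine LipschitzWith.of_le_add_mul L fun x y => ciSup_le fun u => ?_
    have h1 := le_ciSup (hbdd y) u
    have h2 := hmul u (x - y)
    rw [Real.dist_eq]
    linarith
  · intro x hx
    refine le_antisymm (ciSup_le fun u => hpf u x hx) ?_
    simpa using le_ciSup (hbdd x) ⟨x, hx⟩

/-! ### The Moreau envelope -/

/-- The Moreau envelope `s ↦ inf_x (f(x) + (x - s)² / 2)`. -/
noncomputable def moreauEnv (f : ℝ → ℝ) (s : ℝ) : ℝ := ⨅ x : ℝ, f x + (x - s) ^ 2 / 2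

section Moreau

variable {f : ℝ → ℝ} {L : ℝ≥0}

theorem moreauEnv_lower (hL : LipschitzWith L f) (s x : ℝ) :
    f s - (L : ℝ) ^ 2 / 2 ≤ f x + (x - s) ^ 2 / 2 := by
  have h := hL.dist_le_mul s x
  rw [Real.dist_eq, Real.dist_eq] at h
  have h1 := (abs_le.1 h).2
  have h2 : |s - x| ^ 2 = (x - s) ^ 2 := by rw [sq_abs]; ring
  nlinarith [sq_nonneg ((L : ℝ) - |s - x|)]

theorem moreauEnv_le (hL : LipschitzWith L f) (s x : ℝ) :
    moreauEnv f s ≤ f x + (x - s) ^ 2 / 2 :=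
  ciInf_le ⟨_, by rintro _ ⟨x, rfl⟩; exact moreauEnv_lower hL s x⟩ x

theorem le_moreauEnv (hL : LipschitzWith L f) (s : ℝ) :
    f s - (L : ℝ) ^ 2 / 2 ≤ moreauEnv f s :=
  le_ciInf fun x => moreauEnv_lower hL s x

theorem moreauEnv_second_diff_nonneg (hf : ConvexOn ℝ Set.univ f) (hL : LipschitzWith L f)
    (s h : ℝ) : 2 * moreauEnv f (s + h) ≤ moreauEnv f s + moreauEnv f (s + 2 * h) := by
  have key : ∀ x y : ℝ, 2 * moreauEnv f (s + h) ≤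
      (f x + (x - s) ^ 2 / 2) + (f y + (y - (s + 2 * h)) ^ 2 / 2) := by
    intro x y
    have h1 := moreauEnv_le hL (s + h) ((1 / 2) * x + (1 / 2) * y)
    have h2 := hf.2 (Set.mem_univ x) (Set.mem_univ y) (by norm_num : (0 : ℝ) ≤ 1 / 2)
      (by norm_num : (0 : ℝ) ≤ 1 / 2) (by norm_num)
    simp only [smul_eq_mul] at h2
    nlinarith [sq_nonneg ((x - s) - (y - (s + 2 * h)))]
  have h1 : ∀ x, 2 * moreauEnv f (s + h) - (f x + (x - s) ^ 2 / 2) ≤ moreauEnv f (s + 2 * h) :=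
    fun x => le_ciInf fun y => by linarith [key x y]
  have h2 : 2 * moreauEnv f (s + h) - moreauEnv f (s + 2 * h) ≤ moreauEnv f s :=
    le_ciInf fun x => by linarith [h1 x]
  linarith

theorem moreauEnv_second_diff_le (hL : LipschitzWith L f) (s h : ℝ) :
    moreauEnv f s + moreauEnv f (s + 2 * h) ≤ 2 * moreauEnv f (s + h) + h ^ 2 := by
  have : (moreauEnv f s + moreauEnv f (s + 2 * h) - h ^ 2) / 2 ≤ moreauEnv f (s + h) :=
    le_ciInf fun x => by
      have h1 := moreauEnv_le hL s x
      have h2 := moreauEnv_le hL (s + 2 * h) x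
      nlinarith
  linarith

/-- A convex function is recovered from its Moreau envelope at a point `s` close to `x + p`, where
`p` is a subgradient at `x`, with an error that is quadratic in the distance. -/
theorem le_moreauEnv_of_subgradient {x p : ℝ} (hp : ∀ v, f x + p * (v - x) ≤ f v) (s : ℝ) :
    f x ≤ moreauEnv f s - (x - s) ^ 2 / 2 + (s - (x + p)) ^ 2 / 2 := by
  have : f x + (x - s) ^ 2 / 2 - (s - (x + p)) ^ 2 / 2 ≤ moreauEnv f s :=
    le_ciInf fun y => by nlinarith [hp y, sq_nonneg (y - s + p)]
  linarith

end Moreau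

/-! ### Metric entropy of ridge functions with a convex Lipschitz profile -/

theorem exists_finset_of_code {α β : Type*} (G : Set α) (c : α → β) (s : Finset β)
    (hc : ∀ g ∈ G, c g ∈ s) :
    ∃ N : Finset α, (N : Set α) ⊆ G ∧ N.card ≤ s.card ∧ ∀ g ∈ G, ∃ g' ∈ N, c g' = c g := by
  obtain ⟨t, htG, ht⟩ := Set.exists_subset_bijOn G c
  have hfin : (c '' G).Finite := s.finite_toSet.subset (by rintro _ ⟨g, hg, rfl⟩; exact hc g hg)
  have htfin : t.Finite := (ht.finite_iff_finite).2 hfin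
  refine ⟨htfin.toFinset, by simpa using htG, ?_, ?_⟩
  · refine Finset.card_le_card_of_injOn c (fun g hg => hc g (htG (by simpa using hg))) ?_
    simpa using ht.injOn
  · intro g hg
    obtain ⟨g', hg', h⟩ := ht.surjOn ⟨g, hg, rfl⟩
    exact ⟨g', by simpa using hg', h⟩

/-- A sequence with prescribed first two terms and second differences is determined. -/
theorem eq_of_second_diff_eq {v w : ℕ → ℤ} {J : ℕ} (h0 : v 0 = w 0) (h1 : v 1 = w 1)
    (h : ∀ j < J, v (j + 2) - 2 * v (j + 1) + v j = w (j + 2) - 2 * w (j + 1) + w j) :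
    ∀ j < J + 2, v j = w j := by
  intro j
  induction j using Nat.strong_induction_on with
  | _ j ih =>
    match j with
    | 0 => exact fun _ => h0
    | 1 => exact fun _ => h1
    | j + 2 =>
      intro hj
      have a := ih j (by omega) (by omega)
      have b := ih (j + 1) (by omega) (by omega)
      have c := h j (by omega)
      rw [a, b] at c
      linarith

/-- The quantized values of the Moreau envelope on the grid `-S + j / κ`. -/
noncomputable def envCode (S κ : ℝ) (f : ℝ → ℝ) (j : ℕ) : ℤ :=
  ⌊moreauEnv f (-S + j * (1 / κ)) * κ ^ 2⌋

theorem envCode_second_diff_mem {f : ℝ → ℝ} {L : ℝ≥0} (hf : ConvexOn ℝ Set.univ f)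
    (hL : LipschitzWith L f) (S : ℝ) {κ : ℝ} (hκ : 0 < κ) (j : ℕ) :
    envCode S κ f (j + 2) - 2 * envCode S κ f (j + 1) + envCode S κ f j ∈ Finset.Icc (-1 : ℤ) 2 := by
  have h1 := moreauEnv_second_diff_nonneg hf hL (-S + j * (1 / κ)) (1 / κ)
  have h2 := moreauEnv_second_diff_le hL (-S + j * (1 / κ)) (1 / κ)
  have e1 : -S + j * (1 / κ) + 1 / κ = -S + ((j + 1 : ℕ) : ℝ) * (1 / κ) := by push_cast; ring
  have e2 : -S + j * (1 / κ) + 2 * (1 / κ) = -S + ((j + 2 : ℕ) : ℝ) * (1 / κ) := by push_cast; ring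
  rw [e1, e2] at h1 h2
  have hκ2 : 0 < κ ^ 2 := by positivity
  have h1' := mul_le_mul_of_nonneg_right h1 hκ2.le
  have h2' := mul_le_mul_of_nonneg_right h2 hκ2.le
  have e3 : (1 / κ) ^ 2 * κ ^ 2 = 1 := by field_simp
  rw [add_mul, mul_assoc] at h1'
  rw [add_mul, add_mul, mul_assoc, e3] at h2'
  unfold envCode
  set a := moreauEnv f (-S + j * (1 / κ)) * κ ^ 2
  set b := moreauEnv f (-S + ((j + 1 : ℕ) : ℝ) * (1 / κ)) * κ ^ 2
  set c := moreauEnv f (-S + ((j + 2 : ℕ) : ℝ) * (1 / κ)) * κ ^ 2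
  have ha := Int.floor_le a
  have ha' := Int.lt_floor_add_one a
  have hb := Int.floor_le b
  have hb' := Int.lt_floor_add_one b
  have hc := Int.floor_le c
  have hc' := Int.lt_floor_add_one c
  have l1 : (-2 : ℝ) < ((⌊c⌋ - 2 * ⌊b⌋ + ⌊a⌋ : ℤ) : ℝ) := by push_cast; linarith
  have l2 : ((⌊c⌋ - 2 * ⌊b⌋ + ⌊a⌋ : ℤ) : ℝ) < 3 := by push_cast; linarith
  rw [Finset.mem_Icc]
  constructor
  · have : (-2 : ℤ) < ⌊c⌋ - 2 * ⌊b⌋ + ⌊a⌋ := by exact_mod_cast l1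
    omega
  · have : ⌊c⌋ - 2 * ⌊b⌋ + ⌊a⌋ < (3 : ℤ) := by exact_mod_cast l2
    omega

theorem abs_sub_le_of_floor_eq {a b c : ℝ} (hc : 0 < c) (h : ⌊a * c⌋ = ⌊b * c⌋) :
    |a - b| ≤ 1 / c := by
  have := Int.abs_sub_lt_one_of_floor_eq_floor h
  rw [← sub_mul, abs_mul, abs_of_pos hc] at this
  rw [le_div_iff₀ hc]
  exact this.le

/-- Convex functions with the same quantized Moreau envelope are uniformly close. -/
theorem sub_le_of_envCode_eq {f g : ℝ → ℝ} {L : ℝ≥0} (hf : ConvexOn ℝ Set.univ f)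
    (hfL : LipschitzWith L f) (hgL : LipschitzWith L g) {T κ : ℝ} (hκ : 0 < κ) {J : ℕ}
    (hJ : 2 * (T + L) * κ < J + 2) (hcode : ∀ j < J + 2, envCode (T + L) κ f j =
      envCode (T + L) κ g j) {x : ℝ} (hx : |x| ≤ T) :
    f x - g x ≤ 2 * (1 / κ ^ 2) := by
  obtain ⟨p, hpL, hp⟩ := ((convexFunOn_iff convex_univ f).2 hf).exists_subgradient
    hfL.lipschitzOnWith (Set.mem_univ x)
  -- the grid point just below `x + p`
  have hxp : 0 ≤ x + p + (T + L) := by linarith [(abs_le.1 hx).1, (abs_le.1 hpL).1]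
  have hpos : 0 ≤ (x + p + (T + L)) * κ := by positivity
  set j := ⌊(x + p + (T + L)) * κ⌋₊ with hj
  have hj1 := Nat.floor_le hpos
  have hj2 := Nat.lt_floor_add_one ((x + p + (T + L)) * κ)
  rw [← hj] at hj1 hj2
  have hjJ : j < J + 2 := by
    have : (j : ℝ) < ((J + 2 : ℕ) : ℝ) := by
      push_cast
      refine lt_of_le_of_lt hj1 (lt_of_le_of_lt ?_ hJ)
      gcongr
      linarith [(abs_le.1 hx).2, (abs_le.1 hpL).2]
    exact_mod_cast this
  set s := -(T + (L : ℝ)) + j * (1 / κ) with hs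
  have hsd : (s - (x + p)) ^ 2 ≤ 1 / κ ^ 2 := by
    have e : s - (x + p) = -(((x + p + (T + L)) * κ - j) / κ) := by rw [hs]; field_simp; ring
    rw [e, neg_sq, div_pow]
    gcongr
    nlinarith
  have h1 := le_moreauEnv_of_subgradient (fun v => hp v (Set.mem_univ v)) s
  have h2 := moreauEnv_le hgL s x
  have h3 := (abs_le.1 (abs_sub_le_of_floor_eq (by positivity) (hcode j hjJ))).2
  rw [← hs] at h3
  have : 0 ≤ 1 / κ ^ 2 := by positivity
  linarith

/-- The ridge functions `x ↦ m(θᵀx)`, where `m` is convex and `L`-Lipschitz on the line with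
`|m(0)| ≤ M`, and `‖θ‖ ≤ 1`. -/
def ridgeClass (d : ℕ) (L : ℝ≥0) (M : ℝ) : Set (EuclideanSpace ℝ (Fin d) → ℝ) :=
  {g | ∃ (m : ℝ → ℝ) (θ : EuclideanSpace ℝ (Fin d)), ConvexOn ℝ Set.univ m ∧ LipschitzWith L m ∧
    |m 0| ≤ M ∧ ‖θ‖ ≤ 1 ∧ g = fun x => m (inner ℝ θ x)}

section Ridge

variable {d : ℕ} {L : ℝ≥0} {M : ℝ}

theorem continuous_of_mem_ridgeClass {g : EuclideanSpace ℝ (Fin d) → ℝ}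
    (hg : g ∈ ridgeClass d L M) : Continuous g := by
  obtain ⟨m, θ, -, hm, -, -, rfl⟩ := hg
  exact hm.continuous.comp (by fun_prop)

theorem abs_inner_le_of_norm_le_one {θ x : EuclideanSpace ℝ (Fin d)} {T : ℝ} (hθ : ‖θ‖ ≤ 1)
    (hx : ‖x‖ ≤ T) : |inner ℝ θ x| ≤ T :=
  (abs_real_inner_le_norm θ x).trans
    ((mul_le_of_le_one_left (norm_nonneg x) hθ).trans hx)

theorem abs_le_of_lipschitz {m : ℝ → ℝ} (hm : LipschitzWith L m) (h0 : |m 0| ≤ M) {t T : ℝ}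
    (ht : |t| ≤ T) : |m t| ≤ M + L * T := by
  have h := hm.dist_le_mul t 0
  rw [Real.dist_eq, Real.dist_eq, sub_zero] at h
  have h1 : (L : ℝ) * |t| ≤ L * T := by gcongr
  have h2 := abs_sub_abs_le_abs_sub (m t) (m 0)
  linarith

theorem abs_le_of_mem_ridgeClass {g : EuclideanSpace ℝ (Fin d) → ℝ}
    (hg : g ∈ ridgeClass d L M) {T : ℝ} {x : EuclideanSpace ℝ (Fin d)} (hx : ‖x‖ ≤ T) :
    |g x| ≤ M + L * T := by
  obtain ⟨m, θ, -, hm, h0, hθ, rfl⟩ := hg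
  exact abs_le_of_lipschitz hm h0 (abs_inner_le_of_norm_le_one hθ hx)

theorem abs_envCode_le {f : ℝ → ℝ} (hL : LipschitzWith L f) (h0 : |f 0| ≤ M) {S κ B : ℝ}
    {j : ℕ} (hκ : 1 ≤ κ) (hB : M + L * (S + 1) + (L : ℝ) ^ 2 ≤ B) (hS : 0 ≤ S)
    (hj : (j : ℝ) ≤ 1) :
    envCode S κ f j ∈ Finset.Icc (-(⌈B * κ ^ 2⌉₊ + 1 : ℤ)) (⌈B * κ ^ 2⌉₊ + 1 : ℤ) := by
  set s := -S + j * (1 / κ) with hs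
  have hκ0 : 0 < κ := by linarith
  have hsle : |s| ≤ S + 1 := by
    have : 0 ≤ (j : ℝ) * (1 / κ) := by positivity
    have : (j : ℝ) * (1 / κ) ≤ 1 * 1 := by
      gcongr
      rw [div_le_one hκ0]; exact hκ
    rw [abs_le]
    constructor <;> linarith
  have hf := abs_le.1 (abs_le_of_lipschitz hL h0 hsle)
  have h1 := le_moreauEnv hL s
  have h2 := moreauEnv_le hL s s
  have hb : |moreauEnv f s| ≤ B := by
    rw [abs_le]
    constructor
    · nlinarith [sq_nonneg (L : ℝ)]
    · simp only [sub_self] at h2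
      nlinarith [sq_nonneg (L : ℝ)]
  have hκ2 : 0 < κ ^ 2 := by positivity
  have hc : |moreauEnv f s * κ ^ 2| ≤ (⌈B * κ ^ 2⌉₊ : ℝ) := by
    rw [abs_mul, abs_of_pos hκ2]
    exact (mul_le_mul_of_nonneg_right hb hκ2.le).trans (Nat.le_ceil _)
  rw [abs_le] at hc
  rw [Finset.mem_Icc]
  constructor
  · refine Int.le_floor.2 ?_
    push_cast
    linarith
  · have : (⌊moreauEnv f s * κ ^ 2⌋ : ℝ) ≤ ((⌈B * κ ^ 2⌉₊ : ℤ) : ℝ) :=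
      (Int.floor_le _).trans (by simpa using hc.2)
    have : ⌊moreauEnv f s * κ ^ 2⌋ ≤ (⌈B * κ ^ 2⌉₊ : ℤ) := by exact_mod_cast this
    have e : envCode S κ f j = ⌊moreauEnv f s * κ ^ 2⌋ := rfl
    omega

theorem card_Icc_ceil_le {B κ : ℝ} (hB : 0 ≤ B) (hκ : 1 ≤ κ) :
    ((Finset.Icc (-(⌈B * κ ^ 2⌉₊ + 1 : ℤ)) (⌈B * κ ^ 2⌉₊ + 1 : ℤ)).card : ℝ) ≤
      Real.exp ((2 * B + 7) * κ) := by
  have hκ2 : 1 ≤ κ ^ 2 := one_le_pow₀ hκ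
  have h1 : (⌈B * κ ^ 2⌉₊ : ℝ) < B * κ ^ 2 + 1 := Nat.ceil_lt_add_one (by positivity)
  have h2 : ((Finset.Icc (-(⌈B * κ ^ 2⌉₊ + 1 : ℤ)) (⌈B * κ ^ 2⌉₊ + 1 : ℤ)).card : ℝ)
      = 2 * (⌈B * κ ^ 2⌉₊ : ℝ) + 3 := by
    rw [Int.card_Icc]
    have : ((⌈B * κ ^ 2⌉₊ + 1 : ℤ) + 1 - -(⌈B * κ ^ 2⌉₊ + 1 : ℤ)).toNat = 2 * ⌈B * κ ^ 2⌉₊ + 3 := by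
      omega
    rw [this]
    push_cast
    ring
  rw [h2]
  have h3 : 2 * B + 5 ≤ Real.exp ((2 * B + 5) * κ) := by
    refine le_trans ?_ ((Real.add_one_le_exp _))
    nlinarith
  have h4 : κ ≤ Real.exp κ := by linarith [Real.add_one_le_exp κ]
  calc 2 * (⌈B * κ ^ 2⌉₊ : ℝ) + 3 ≤ (2 * B + 5) * κ ^ 2 := by nlinarith
    _ ≤ Real.exp ((2 * B + 5) * κ) * Real.exp κ ^ 2 := by gcongr
    _ = Real.exp ((2 * B + 7) * κ) := by
      rw [← Real.exp_nat_mul, ← Real.exp_add]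
      congr 1
      push_cast
      ring

/-- The entropy bound at the scale produced by the coding: the sup-norm resolution is a fixed
multiple of `κ⁻²`, while the logarithm of the number of functions is of order `κ`. -/
theorem exists_ridge_net_aux (d : ℕ) (L : ℝ≥0) {M T : ℝ} (hM : 0 ≤ M) (hT : 0 ≤ T) :
    ∃ A : ℝ, 0 ≤ A ∧ ∀ κ : ℝ, 1 ≤ κ → ∃ N : Finset (EuclideanSpace ℝ (Fin d) → ℝ),
      (N : Set _) ⊆ ridgeClass d L M ∧ (N.card : ℝ) ≤ Real.exp (A * κ) ∧
      ∀ g ∈ ridgeClass d L M, ∃ g' ∈ N, ∀ x, ‖x‖ ≤ T →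
        |g x - g' x| ≤ (2 + d * L * T) * (1 / κ ^ 2) := by
  classical
  have hS : 0 ≤ T + (L : ℝ) := by positivity
  set B : ℝ := M + L * (T + L + 1) + (L : ℝ) ^ 2 with hBdef
  have hB : 0 ≤ B := by positivity
  refine ⟨2 * (2 * B + 7) + 4 * (T + L) + 9 * d, by positivity, fun κ hκ => ?_⟩
  have hκ0 : 0 < κ := by linarith
  set J := ⌊2 * (T + L) * κ⌋₊ with hJ
  have hJ1 : (J : ℝ) ≤ 2 * (T + L) * κ := Nat.floor_le (by positivity)
  have hJ2 : 2 * (T + L) * κ < J + 2 := by linarith [Nat.lt_floor_add_one (2 * (T + L) * κ)]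
  let I : ℝ → Finset ℤ := fun b => Finset.Icc (-(⌈b * κ ^ 2⌉₊ + 1 : ℤ)) (⌈b * κ ^ 2⌉₊ + 1 : ℤ)
  let G : Set ((ℝ → ℝ) × EuclideanSpace ℝ (Fin d)) :=
    {z | ConvexOn ℝ Set.univ z.1 ∧ LipschitzWith L z.1 ∧ |z.1 0| ≤ M ∧ ‖z.2‖ ≤ 1}
  let c : (ℝ → ℝ) × EuclideanSpace ℝ (Fin d) → (ℤ × ℤ) × (Fin J → ℤ) × (Fin d → ℤ) := fun z =>
    ((envCode (T + L) κ z.1 0, envCode (T + L) κ z.1 1),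
      fun j => envCode (T + L) κ z.1 (j + 2) - 2 * envCode (T + L) κ z.1 (j + 1) +
        envCode (T + L) κ z.1 j,
      fun i => ⌊z.2 i * κ ^ 2⌋)
  let s : Finset ((ℤ × ℤ) × (Fin J → ℤ) × (Fin d → ℤ)) :=
    (I B ×ˢ I B) ×ˢ (Fintype.piFinset fun _ => Finset.Icc (-1) 2) ×ˢ
      (Fintype.piFinset fun _ => I 1)
  have hc : ∀ z ∈ G, c z ∈ s := by
    rintro ⟨m, θ⟩ ⟨hm, hmL, hm0, hθ⟩
    simp only [s, c, Finset.mem_product, Fintype.mem_piFinset]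
    refine ⟨⟨?_, ?_⟩, fun j => ?_, fun i => ?_⟩
    · exact abs_envCode_le hmL hm0 hκ le_rfl hS (by simp)
    · exact abs_envCode_le hmL hm0 hκ le_rfl hS (by simp)
    · exact envCode_second_diff_mem hm hmL _ hκ0 _
    · have h1 : |θ i| ≤ 1 := by
        simpa using (PiLp.norm_apply_le θ i).trans hθ
      rw [abs_le] at h1
      have hκ2 : 0 < κ ^ 2 := by positivity
      have h2 := Nat.le_ceil (1 * κ ^ 2)
      simp only [I, Finset.mem_Icc]
      constructor
      · refine Int.le_floor.2 ?_
        push_cast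
        nlinarith
      · have : (⌊θ i * κ ^ 2⌋ : ℝ) ≤ ((⌈1 * κ ^ 2⌉₊ : ℤ) : ℝ) :=
          (Int.floor_le _).trans (by push_cast; nlinarith)
        have : ⌊θ i * κ ^ 2⌋ ≤ (⌈1 * κ ^ 2⌉₊ : ℤ) := by exact_mod_cast this
        omega
  obtain ⟨N, hNG, hNcard, hN⟩ := exists_finset_of_code G c s hc
  refine ⟨N.image fun z x => z.1 (inner ℝ z.2 x), ?_, ?_, ?_⟩
  · intro g hg
    obtain ⟨z, hz, rfl⟩ := Finset.mem_image.1 (Finset.mem_coe.1 hg)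
    obtain ⟨h1, h2, h3, h4⟩ := hNG hz
    exact ⟨z.1, z.2, h1, h2, h3, h4, rfl⟩
  · have hIB : ((I B).card : ℝ) ≤ Real.exp ((2 * B + 7) * κ) := card_Icc_ceil_le hB hκ
    have hI1 : ((I 1).card : ℝ) ≤ Real.exp ((2 * 1 + 7) * κ) := card_Icc_ceil_le zero_le_one hκ
    have h4 : (4 : ℝ) ≤ Real.exp 2 := by
      have h := Real.add_one_le_exp (1 : ℝ)
      have e : Real.exp 2 = Real.exp 1 * Real.exp 1 := by rw [← Real.exp_add]; norm_num
      nlinarith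
    have hs : (s.card : ℝ) = ((I B).card * (I B).card) * (4 ^ J * (I 1).card ^ d) := by
      simp only [s, Finset.card_product, Fintype.card_piFinset, Finset.prod_const,
        Finset.card_univ, Fintype.card_fin, Int.card_Icc]
      push_cast
      norm_num
    calc ((N.image fun z x => z.1 (inner ℝ z.2 x)).card : ℝ) ≤ s.card := by
          exact_mod_cast Finset.card_image_le.trans hNcard
      _ ≤ (Real.exp ((2 * B + 7) * κ) * Real.exp ((2 * B + 7) * κ)) *
          (Real.exp 2 ^ J * Real.exp ((2 * 1 + 7) * κ) ^ d) := by
        rw [hs]; gcongr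
      _ = Real.exp (2 * (2 * B + 7) * κ + 2 * J + 9 * d * κ) := by
        rw [← Real.exp_nat_mul, ← Real.exp_nat_mul, ← Real.exp_add, ← Real.exp_add,
          ← Real.exp_add]
        congr 1
        ring
      _ ≤ Real.exp ((2 * (2 * B + 7) + 4 * (T + L) + 9 * d) * κ) := by
        refine Real.exp_le_exp.2 ?_
        nlinarith
  · rintro _ ⟨m, θ, hm, hmL, hm0, hθ, rfl⟩
    obtain ⟨⟨m', θ'⟩, hz, hcode⟩ := hN (m, θ) ⟨hm, hmL, hm0, hθ⟩
    obtain ⟨hm', hmL', -, hθ'⟩ := hNG hz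
    refine ⟨_, Finset.mem_image_of_mem _ hz, fun x hx => ?_⟩
    simp only [c, Prod.mk.injEq] at hcode
    obtain ⟨⟨hc0, hc1⟩, hc2, hc3⟩ := hcode
    have hκ2 : 0 < κ ^ 2 := by positivity
    have hθd : ∀ i, |θ i - θ' i| ≤ 1 / κ ^ 2 := fun i =>
      abs_sub_le_of_floor_eq hκ2 (congrFun hc3 i).symm
    have henv : ∀ j < J + 2, envCode (T + L) κ m j = envCode (T + L) κ m' j :=
      eq_of_second_diff_eq hc0.symm hc1.symm fun j hj => (congrFun hc2 ⟨j, hj⟩).symm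
    have ht := abs_inner_le_of_norm_le_one hθ' hx
    have h1 := sub_le_of_envCode_eq hm hmL hmL' hκ0 hJ2 henv ht
    have h2 := sub_le_of_envCode_eq hm' hmL' hmL hκ0 hJ2 (fun j hj => (henv j hj).symm) ht
    have h3 : |inner ℝ θ x - inner ℝ θ' x| ≤ d * (1 / κ ^ 2 * T) := by
      rw [← inner_sub_left, PiLp.inner_apply]
      refine (Finset.abs_sum_le_sum_abs _ _).trans ?_
      have : ∀ i ∈ Finset.univ, |inner ℝ ((θ - θ') i) (x i)| ≤ 1 / κ ^ 2 * T := by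
        intro i _
        have hxi : |x i| ≤ T := by simpa using (PiLp.norm_apply_le x i).trans hx
        simp only [PiLp.sub_apply, RCLike.inner_apply, conj_trivial]
        rw [abs_mul, mul_comm]
        gcongr
        exact hθd i
      simpa using Finset.sum_le_sum this
    have h4 : |m (inner ℝ θ x) - m (inner ℝ θ' x)| ≤ L * (d * (1 / κ ^ 2 * T)) := by
      have h := hmL.dist_le_mul (inner ℝ θ x) (inner ℝ θ' x)
      rw [Real.dist_eq, Real.dist_eq] at h
      exact h.trans (by gcongr)
    have h5 : |m (inner ℝ θ' x) - m' (inner ℝ θ' x)| ≤ 2 * (1 / κ ^ 2) :=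
      abs_le.2 ⟨by linarith, h1⟩
    have h6 := abs_sub_le (m (inner ℝ θ x)) (m (inner ℝ θ' x)) (m' (inner ℝ θ' x))
    calc _ ≤ _ := h6
      _ ≤ (2 + d * L * T) * (1 / κ ^ 2) := by linarith

/-- Metric entropy of ridge functions with convex Lipschitz profile: in the sup norm on a ball,
`log N(κ⁻²) = O(κ)`, that is, `log N(η) = O(η^(-1/2))`. -/
theorem exists_ridge_net (d : ℕ) (L : ℝ≥0) {M T : ℝ} (hM : 0 ≤ M) (hT : 0 ≤ T) :
    ∃ A : ℝ, 0 ≤ A ∧ ∀ κ : ℝ, 1 ≤ κ → ∃ N : Finset (EuclideanSpace ℝ (Fin d) → ℝ),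
      (N : Set _) ⊆ ridgeClass d L M ∧ (N.card : ℝ) ≤ Real.exp (A * κ) ∧
      ∀ g ∈ ridgeClass d L M, ∃ g' ∈ N, ∀ x, ‖x‖ ≤ T → |g x - g' x| ≤ 1 / κ ^ 2 := by
  obtain ⟨A, hA, h⟩ := exists_ridge_net_aux d L hM hT
  set C : ℝ := 2 + d * L * T with hC
  have hC1 : 1 ≤ C := by
    have : 0 ≤ (d : ℝ) * L * T := by positivity
    linarith
  refine ⟨A * C, by positivity, fun κ hκ => ?_⟩
  obtain ⟨N, h1, h2, h3⟩ := h (C * κ) (by nlinarith)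
  refine ⟨N, h1, by rwa [mul_assoc], fun g hg => ?_⟩
  obtain ⟨g', hg', hd⟩ := h3 g hg
  refine ⟨g', hg', fun x hx => (hd x hx).trans ?_⟩
  have hκ0 : 0 < κ := by linarith
  rw [mul_one_div, div_le_div_iff₀ (by positivity) (by positivity)]
  nlinarith [mul_le_mul_of_nonneg_right hC1 (by positivity : 0 ≤ C * κ ^ 2)]

end Ridge

/-! ### Exponential moments under conditional sub-Gaussianity -/

theorem exp_neg_one_le_half : Real.exp (-1) ≤ 1 / 2 := by
  rw [Real.exp_neg, one_div]
  have := Real.add_one_le_exp (1 : ℝ)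
  exact inv_anti₀ two_pos (by linarith)

theorem exp_le_add_exp_sq (x : ℝ) : Real.exp x ≤ x + Real.exp (x ^ 2) := by
  have h2 := Real.add_one_le_exp (x ^ 2)
  rcases le_or_gt |x| 1 with h | h
  · have := (abs_le.1 (Real.abs_exp_sub_one_sub_id_le h)).2
    linarith
  · rcases lt_abs.1 h with h | h
    · have : Real.exp x ≤ Real.exp (x ^ 2) := Real.exp_le_exp.2 (by nlinarith)
      linarith
    · have : Real.exp x ≤ 1 := Real.exp_le_one_iff.2 (by linarith)
      nlinarith

/-- Chord bound for the exponential between `0` and `z`. -/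
theorem exp_mul_le_chord {θ z : ℝ} (h0 : 0 ≤ θ) (h1 : θ ≤ 1) :
    Real.exp (θ * z) ≤ 1 + θ * (Real.exp z - 1) := by
  have h := convexOn_exp.2 (Set.mem_univ 0) (Set.mem_univ z) (sub_nonneg.2 h1) h0
    (sub_add_cancel 1 θ)
  simp only [smul_eq_mul, mul_zero, zero_add, Real.exp_zero, mul_one] at h
  linarith

/-- Pointwise bound of `exp (a e)` by an affine function of `e` and `exp (e² / K) - 1`; for large
`a` the linear term is dropped. -/
theorem exp_mul_le_affine {K : ℝ} (hK : 0 < K) (a e : ℝ) :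
    Real.exp (a * e) ≤ (if K * a ^ 2 ≤ 1 then a else 0) * e +
      (if K * a ^ 2 ≤ 1 then 1 else Real.exp (K * a ^ 2 / 2)) +
      (if K * a ^ 2 ≤ 1 then K * a ^ 2 else Real.exp (K * a ^ 2 / 2) / 2) *
        (Real.exp (e ^ 2 / K) - 1) := by
  split_ifs with h
  · have h1 := exp_le_add_exp_sq (a * e)
    have h2 := exp_mul_le_chord (z := e ^ 2 / K) (by positivity) h
    have e1 : K * a ^ 2 * (e ^ 2 / K) = (a * e) ^ 2 := by field_simp
    rw [e1] at h2
    linarith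
  · have h2 := exp_mul_le_chord (θ := 1 / 2) (z := e ^ 2 / K) (by norm_num) (by norm_num)
    have h3 : a * e ≤ K * a ^ 2 / 2 + 1 / 2 * (e ^ 2 / K) := by
      have : 0 ≤ (K * a - e) ^ 2 / (2 * K) := by positivity
      have e1 : (K * a - e) ^ 2 / (2 * K) = K * a ^ 2 / 2 + 1 / 2 * (e ^ 2 / K) - a * e := by
        field_simp; ring
      linarith
    calc Real.exp (a * e) ≤ Real.exp (K * a ^ 2 / 2) * Real.exp (1 / 2 * (e ^ 2 / K)) := by
          rw [← Real.exp_add]; exact Real.exp_le_exp.2 h3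
      _ ≤ Real.exp (K * a ^ 2 / 2) * (1 + 1 / 2 * (Real.exp (e ^ 2 / K) - 1)) := by gcongr
      _ = _ := by ring

theorem coeff_le_exp {K : ℝ} (hK : 0 < K) (a : ℝ) :
    (if K * a ^ 2 ≤ 1 then 1 else Real.exp (K * a ^ 2 / 2)) +
      (if K * a ^ 2 ≤ 1 then K * a ^ 2 else Real.exp (K * a ^ 2 / 2) / 2) * (1 / K) ≤
    Real.exp ((1 + K / 2) * a ^ 2) := by
  split_ifs with h
  · have e1 : 1 + K * a ^ 2 * (1 / K) = a ^ 2 + 1 := by field_simp; ring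
    rw [e1]
    refine (Real.add_one_le_exp _).trans (Real.exp_le_exp.2 ?_)
    have : 0 ≤ K * a ^ 2 := by positivity
    linarith
  · have h1 := Real.add_one_le_exp (1 / (2 * K))
    have h2 : 1 / (2 * K) ≤ a ^ 2 := by
      rw [div_le_iff₀ (by positivity)]
      nlinarith
    calc _ = Real.exp (K * a ^ 2 / 2) * (1 / (2 * K) + 1) := by field_simp; ring
      _ ≤ Real.exp (K * a ^ 2 / 2) * Real.exp (1 / (2 * K)) := by gcongr
      _ ≤ _ := by
        rw [← Real.exp_add]
        exact Real.exp_le_exp.2 (by linarith)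

section CondExp

variable {Ω : Type*} {mΩ : MeasurableSpace Ω} {μ : Measure Ω} [IsProbabilityMeasure μ]

theorem integral_mul_eq_integral_mul_condExp {m : MeasurableSpace Ω} (hm : m ≤ mΩ) {f g : Ω → ℝ}
    (hf : StronglyMeasurable[m] f) {c : ℝ} (hfc : ∀ᵐ ω ∂μ, ‖f ω‖ ≤ c) (hg : Integrable g μ) :
    ∫ ω, f ω * g ω ∂μ = ∫ ω, f ω * (μ[g | m]) ω ∂μ := by
  have hfg : Integrable (f * g) μ := hg.bdd_mul (hf.mono hm).aestronglyMeasurable hfc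
  have h := condExp_mul_of_stronglyMeasurable_left hf hfg hg
  calc ∫ ω, f ω * g ω ∂μ = ∫ ω, (μ[f * g | m]) ω ∂μ := (integral_condExp hm).symm
    _ = _ := integral_congr_ae h

/-- The conditional sub-Gaussian bound in integrated form: conditionally on `X`, the exponential
moment of `a(X) e` is at most `exp ((1 + K / 2) a(X)²)`. -/
theorem integral_exp_le_of_condSubGaussian {E : Type*} [MeasurableSpace E] {X : Ω → E}
    (hX : Measurable X) {e : Ω → ℝ} (hem : Measurable e) (he : Integrable e μ)
    (hmean : μ[e | MeasurableSpace.comap X inferInstance] =ᵐ[μ] 0) {K : ℝ} (hK : 0 < K)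
    (hint : Integrable (fun ω => Real.exp (e ω ^ 2 / K) - 1) μ)
    (hsub : ∀ᵐ ω ∂μ, K * (μ[fun ω' => Real.exp (e ω' ^ 2 / K) - 1 |
      MeasurableSpace.comap X inferInstance]) ω ≤ 1)
    {a b : E → ℝ} (ha : Measurable a) (hb : Measurable b) {c : ℝ}
    (hac : ∀ᵐ ω ∂μ, |a (X ω)| ≤ c) (hbc : ∀ᵐ ω ∂μ, |b (X ω)| ≤ c) :
    Integrable (fun ω => Real.exp (a (X ω) * e ω - b (X ω))) μ ∧
      ∫ ω, Real.exp (a (X ω) * e ω - b (X ω)) ∂μ ≤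
        ∫ ω, Real.exp ((1 + K / 2) * a (X ω) ^ 2 - b (X ω)) ∂μ := by
  set W : Ω → ℝ := fun ω => Real.exp (e ω ^ 2 / K) - 1 with hW
  let u : E → ℝ := fun x => if K * a x ^ 2 ≤ 1 then a x else 0
  let k : E → ℝ := fun x => if K * a x ^ 2 ≤ 1 then 1 else Real.exp (K * a x ^ 2 / 2)
  let v : E → ℝ := fun x => if K * a x ^ 2 ≤ 1 then K * a x ^ 2 else Real.exp (K * a x ^ 2 / 2) / 2
  let w : E → ℝ := fun x => Real.exp (-b x)
  have hset : MeasurableSet {x | K * a x ^ 2 ≤ 1} :=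
    measurableSet_le (by fun_prop) measurable_const
  have hu : Measurable u := Measurable.ite hset ha measurable_const
  have hk : Measurable k := Measurable.ite hset measurable_const (by fun_prop)
  have hv : Measurable v := Measurable.ite hset (by fun_prop) (by fun_prop)
  have hw : Measurable w := by fun_prop
  have hv0 : ∀ x, 0 ≤ v x := fun x => by dsimp only [v]; split_ifs <;> positivity
  have hk0 : ∀ x, 0 ≤ k x := fun x => by dsimp only [k]; split_ifs <;> positivity
  set R := Real.exp ((1 + K / 2) * c ^ 2) with hR
  have hkv : ∀ᵐ ω ∂μ, k (X ω) + v (X ω) * (1 / K) ≤ R := by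
    filter_upwards [hac] with ω hω
    refine (coeff_le_exp hK (a (X ω))).trans (Real.exp_le_exp.2 ?_)
    have : a (X ω) ^ 2 ≤ c ^ 2 := by
      rw [← sq_abs]; exact pow_le_pow_left₀ (abs_nonneg _) hω 2
    gcongr
  have hwc : ∀ᵐ ω ∂μ, w (X ω) ≤ Real.exp c := by
    filter_upwards [hbc] with ω hω
    exact Real.exp_le_exp.2 (by linarith [(abs_le.1 hω).1])
  have hw0 : ∀ x, 0 < w x := fun x => Real.exp_pos _
  have huc : ∀ᵐ ω ∂μ, ‖w (X ω) * u (X ω)‖ ≤ Real.exp c * c := by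
    filter_upwards [hwc, hac] with ω h1 h2
    rw [norm_mul, Real.norm_eq_abs, Real.norm_eq_abs, abs_of_pos (hw0 _)]
    have : |u (X ω)| ≤ c := by
      dsimp only [u]; split_ifs
      · exact h2
      · simpa using (abs_nonneg _).trans h2
    gcongr
  have hvc : ∀ᵐ ω ∂μ, ‖w (X ω) * v (X ω)‖ ≤ Real.exp c * (R * K) := by
    filter_upwards [hwc, hkv] with ω h1 h2
    rw [Real.norm_eq_abs, abs_of_nonneg (mul_nonneg (hw0 _).le (hv0 _))]
    have h3 : v (X ω) * (1 / K) ≤ R := by linarith [hk0 (X ω)]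
    have h4 : v (X ω) ≤ R * K := by rwa [mul_one_div, div_le_iff₀ hK] at h3
    gcongr
  have hkc : ∀ᵐ ω ∂μ, ‖w (X ω) * k (X ω)‖ ≤ Real.exp c * R := by
    filter_upwards [hwc, hkv] with ω h1 h2
    rw [Real.norm_eq_abs, abs_of_nonneg (mul_nonneg (hw0 _).le (hk0 _))]
    have : 0 ≤ v (X ω) * (1 / K) := mul_nonneg (hv0 _) (by positivity)
    have h4 : k (X ω) ≤ R := by linarith
    gcongr
  have hm : MeasurableSpace.comap X inferInstance ≤ mΩ := hX.comap_le
  have hXm : Measurable[MeasurableSpace.comap X inferInstance] X := comap_measurable X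
  have hum : StronglyMeasurable[MeasurableSpace.comap X inferInstance]
      fun ω => w (X ω) * u (X ω) := ((hw.mul hu).comp hXm).stronglyMeasurable
  have hvm : StronglyMeasurable[MeasurableSpace.comap X inferInstance]
      fun ω => w (X ω) * v (X ω) := ((hw.mul hv).comp hXm).stronglyMeasurable
  have i1 : Integrable (fun ω => w (X ω) * u (X ω) * e ω) μ :=
    he.bdd_mul (hum.mono hm).aestronglyMeasurable huc
  have i2 : Integrable (fun ω => w (X ω) * k (X ω)) μ :=
    Integrable.of_bound ((hw.mul hk).comp hX).aestronglyMeasurable _ hkc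
  have i3 : Integrable (fun ω => w (X ω) * v (X ω) * W ω) μ :=
    hint.bdd_mul (hvm.mono hm).aestronglyMeasurable hvc
  have i4 : Integrable (fun ω => w (X ω) * v (X ω)) μ :=
    Integrable.of_bound (hvm.mono hm).aestronglyMeasurable _ hvc
  have hpt : ∀ ω, Real.exp (a (X ω) * e ω - b (X ω)) ≤
      w (X ω) * u (X ω) * e ω + w (X ω) * k (X ω) + w (X ω) * v (X ω) * W ω := by
    intro ω
    have h := mul_le_mul_of_nonneg_left (exp_mul_le_affine hK (a (X ω)) (e ω)) (hw0 (X ω)).le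
    have e1 : w (X ω) * Real.exp (a (X ω) * e ω) = Real.exp (a (X ω) * e ω - b (X ω)) := by
      rw [← Real.exp_add]; congr 1; ring
    rw [e1] at h
    refine h.trans (le_of_eq ?_)
    simp only [u, k, v, W]
    ring
  have hI : Integrable (fun ω => Real.exp (a (X ω) * e ω - b (X ω))) μ := by
    refine ((i1.add i2).add i3).mono' (by fun_prop) (Filter.Eventually.of_forall fun ω => ?_)
    rw [Real.norm_eq_abs, abs_of_pos (Real.exp_pos _)]
    exact hpt ω
  refine ⟨hI, ?_⟩
  have z1 : ∫ ω, w (X ω) * u (X ω) * e ω ∂μ = 0 := by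
    rw [integral_mul_eq_integral_mul_condExp hm hum huc he]
    refine (integral_congr_ae (g := fun _ => (0 : ℝ)) ?_).trans (integral_zero _ _)
    filter_upwards [hmean] with ω h
    simp [h]
  have z3 : ∫ ω, w (X ω) * v (X ω) * W ω ∂μ ≤ ∫ ω, w (X ω) * v (X ω) * (1 / K) ∂μ := by
    rw [integral_mul_eq_integral_mul_condExp hm hvm hvc hint]
    refine integral_mono_ae ?_ (i4.mul_const _) ?_
    · exact integrable_condExp.bdd_mul (hvm.mono hm).aestronglyMeasurable hvc
    · filter_upwards [hsub] with ω h
      refine mul_le_mul_of_nonneg_left ?_ (mul_nonneg (hw0 _).le (hv0 _))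
      rw [le_div_iff₀ hK, mul_comm]
      exact h
  calc ∫ ω, Real.exp (a (X ω) * e ω - b (X ω)) ∂μ
      ≤ ∫ ω, (w (X ω) * u (X ω) * e ω + w (X ω) * k (X ω) + w (X ω) * v (X ω) * W ω) ∂μ :=
        integral_mono hI ((i1.add i2).add i3) hpt
    _ = 0 + ∫ ω, w (X ω) * k (X ω) ∂μ + ∫ ω, w (X ω) * v (X ω) * W ω ∂μ := by
        rw [← z1, ← integral_add i1 i2]
        exact integral_add (i1.add i2) i3
    _ ≤ ∫ ω, w (X ω) * k (X ω) ∂μ + ∫ ω, w (X ω) * v (X ω) * (1 / K) ∂μ := by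
        rw [zero_add]; gcongr
    _ = ∫ ω, (w (X ω) * k (X ω) + w (X ω) * v (X ω) * (1 / K)) ∂μ :=
        (integral_add i2 (i4.mul_const _)).symm
    _ ≤ ∫ ω, Real.exp ((1 + K / 2) * a (X ω) ^ 2 - b (X ω)) ∂μ := by
        refine integral_mono_ae (i2.add (i4.mul_const _)) ?_
          (Filter.Eventually.of_forall fun ω => ?_)
        · refine Integrable.of_bound (by fun_prop) (R * Real.exp c) ?_
          filter_upwards [hac, hbc] with ω h1 h2
          rw [Real.norm_eq_abs, abs_of_pos (Real.exp_pos _), ← Real.exp_add]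
          refine Real.exp_le_exp.2 ?_
          have : a (X ω) ^ 2 ≤ c ^ 2 := by
            rw [← sq_abs]; exact pow_le_pow_left₀ (abs_nonneg _) h1 2
          have := mul_le_mul_of_nonneg_left this (by positivity : 0 ≤ 1 + K / 2)
          linarith [(abs_le.1 h2).1]
        · have h := mul_le_mul_of_nonneg_left (coeff_le_exp hK (a (X ω))) (hw0 (X ω)).le
          have e1 : w (X ω) * Real.exp ((1 + K / 2) * a (X ω) ^ 2) =
              Real.exp ((1 + K / 2) * a (X ω) ^ 2 - b (X ω)) := by
            rw [← Real.exp_add]; congr 1; ring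
          rw [e1, mul_add, ← mul_assoc] at h
          exact h

end CondExp

/-! ### Chernoff bounds for a regression sample -/

/-- Chernoff's bound for sums of i.i.d. variables `φ(W i)`. -/
theorem measureReal_sum_ge_le {Ω β : Type*} [MeasurableSpace Ω] [MeasurableSpace β]
    {μ : Measure Ω} [IsProbabilityMeasure μ] {W : ℕ → Ω → β} (hW : ∀ i, Measurable (W i))
    (hindep : iIndepFun W μ) (hident : ∀ i, IdentDistrib (W i) (W 0) μ μ) {φ : β → ℝ}
    (hφ : Measurable φ) (hint : Integrable (fun ω => Real.exp (φ (W 0 ω))) μ) (n : ℕ) (t : ℝ) :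
    μ.real {ω | t ≤ ∑ i ∈ Finset.range n, φ (W i ω)} ≤
      Real.exp (-t) * (∫ ω, Real.exp (φ (W 0 ω)) ∂μ) ^ n := by
  have hind : iIndepFun (fun i => φ ∘ W i) μ := hindep.comp (fun _ => φ) (fun _ => hφ)
  have hid : ∀ i, IdentDistrib (fun ω => Real.exp (φ (W i ω))) (fun ω => Real.exp (φ (W 0 ω))) μ μ :=
    fun i => (hident i).comp (u := fun z => Real.exp (φ z)) (by fun_prop)
  have h1 : Integrable (fun ω => Real.exp (1 * (∑ i ∈ Finset.range n, φ ∘ W i) ω)) μ := by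
    refine hind.integrable_exp_mul_sum (fun i => hφ.comp (hW i)) fun i _ => ?_
    simpa using (hid i).integrable_iff.2 hint
  have h2 := measure_ge_le_exp_mul_mgf (μ := μ) (X := ∑ i ∈ Finset.range n, φ ∘ W i) t
    zero_le_one h1
  rw [hind.mgf_sum (fun i => hφ.comp (hW i))] at h2
  have h3 : ∀ i ∈ Finset.range n, mgf (φ ∘ W i) μ 1 = ∫ ω, Real.exp (φ (W 0 ω)) ∂μ := by
    intro i _
    simpa [mgf] using (hid i).integral_eq
  rw [Finset.prod_congr rfl h3] at h2
  simpa using h2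

/-- An i.i.d. sample `(X i, e i)` with covariates in the ball of radius `T` and centred noise that
is sub-Gaussian conditionally on the covariate; the last two properties enter through the
exponential moments of `a(X) e - b(X)`. -/
structure SubGaussianSample {Ω : Type*} [MeasurableSpace Ω] (μ : Measure Ω) {d : ℕ}
    (X : ℕ → Ω → EuclideanSpace ℝ (Fin d)) (e : ℕ → Ω → ℝ) (T C : ℝ) : Prop where
  measurable_covariate : ∀ i, Measurable (X i)
  measurable_noise : ∀ i, Measurable (e i)
  indep : iIndepFun (fun i ω => (X i ω, e i ω)) μ
  ident : ∀ i, IdentDistrib (fun ω => (X i ω, e i ω)) (fun ω => (X 0 ω, e 0 ω)) μ μ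
  norm_le : ∀ᵐ ω ∂μ, ‖X 0 ω‖ ≤ T
  pos : 0 < C
  mgf_le : ∀ a b : EuclideanSpace ℝ (Fin d) → ℝ, Measurable a → Measurable b → ∀ c : ℝ,
    (∀ x, ‖x‖ ≤ T → |a x| ≤ c ∧ |b x| ≤ c) →
    Integrable (fun ω => Real.exp (a (X 0 ω) * e 0 ω - b (X 0 ω))) μ ∧
      ∫ ω, Real.exp (a (X 0 ω) * e 0 ω - b (X 0 ω)) ∂μ ≤
        ∫ ω, Real.exp (C * a (X 0 ω) ^ 2 - b (X 0 ω)) ∂μ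

namespace SubGaussianSample

variable {Ω : Type*} [MeasurableSpace Ω] {μ : Measure Ω} [IsProbabilityMeasure μ] {d : ℕ}
  {X : ℕ → Ω → EuclideanSpace ℝ (Fin d)} {e : ℕ → Ω → ℝ} {T C : ℝ}

theorem tail (hs : SubGaussianSample μ X e T C) {a b : EuclideanSpace ℝ (Fin d) → ℝ}
    (ha : Measurable a) (hb : Measurable b) {c : ℝ}
    (hc : ∀ x, ‖x‖ ≤ T → |a x| ≤ c ∧ |b x| ≤ c) (n : ℕ) (t : ℝ) :
    μ.real {ω | t ≤ ∑ i ∈ Finset.range n, (a (X i ω) * e i ω - b (X i ω))} ≤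
      Real.exp (-t) * (∫ ω, Real.exp (C * a (X 0 ω) ^ 2 - b (X 0 ω)) ∂μ) ^ n := by
  obtain ⟨h1, h2⟩ := hs.mgf_le a b ha hb c hc
  have h := measureReal_sum_ge_le (φ := fun z : EuclideanSpace ℝ (Fin d) × ℝ => a z.1 * z.2 - b z.1)
    (fun i => (hs.measurable_covariate i).prodMk (hs.measurable_noise i)) hs.indep hs.ident
    (by fun_prop) h1 n t
  refine h.trans ?_
  gcongr

theorem linear_tail_one_sided (hs : SubGaussianSample μ X e T C)
    {h : EuclideanSpace ℝ (Fin d) → ℝ} (hm : Measurable h) {η : ℝ} (hη : 0 < η)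
    (hh : ∀ x, ‖x‖ ≤ T → |h x| ≤ η) {n : ℕ} (hn : 0 < n) {t : ℝ} (ht : 0 ≤ t) :
    μ.real {ω | t ≤ ∑ i ∈ Finset.range n, h (X i ω) * e i ω} ≤
      Real.exp (-(t ^ 2 / (4 * C * n * η ^ 2))) := by
  have hC := hs.pos
  have hn' : (0 : ℝ) < n := by exact_mod_cast hn
  rcases ht.eq_or_lt with rfl | ht
  · simp
  -- the minimizer of the exponent `-l t + C l² n η²`
  set l := t / (2 * C * n * η ^ 2) with hl
  have hl0 : 0 < l := by positivity
  have hc : ∀ x, ‖x‖ ≤ T → |l * h x| ≤ l * η ∧ |(0 : ℝ)| ≤ l * η := fun x hx => by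
    rw [abs_mul, abs_of_pos hl0, abs_zero]
    exact ⟨by gcongr; exact hh x hx, by positivity⟩
  have h1 := hs.tail (a := fun x => l * h x) (b := fun _ => 0) (by fun_prop) measurable_const hc n
    (l * t)
  have e1 : {ω | l * t ≤ ∑ i ∈ Finset.range n, (l * h (X i ω) * e i ω - 0)} =
      {ω | t ≤ ∑ i ∈ Finset.range n, h (X i ω) * e i ω} := by
    ext ω
    simp only [sub_zero, mul_assoc, ← Finset.mul_sum, Set.mem_ofPred_eq]
    exact mul_le_mul_iff_right₀ hl0
  rw [e1] at h1
  have h2 : ∫ ω, Real.exp (C * (l * h (X 0 ω)) ^ 2 - 0) ∂μ ≤ Real.exp (C * (l * η) ^ 2) := by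
    have : ∀ᵐ ω ∂μ, ‖Real.exp (C * (l * h (X 0 ω)) ^ 2 - 0)‖ ≤ Real.exp (C * (l * η) ^ 2) := by
      filter_upwards [hs.norm_le] with ω hω
      rw [Real.norm_eq_abs, abs_of_pos (Real.exp_pos _), sub_zero, ← sq_abs (l * h _)]
      have := (hc _ hω).1
      gcongr
    have := norm_integral_le_of_norm_le_const this
    simp only [probReal_univ, mul_one] at this
    exact (le_abs_self _).trans this
  calc _ ≤ _ := h1
    _ ≤ Real.exp (-(l * t)) * Real.exp (C * (l * η) ^ 2) ^ n := by
      gcongr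
    _ = _ := by
      rw [← Real.exp_nat_mul, ← Real.exp_add]
      congr 1
      rw [hl]
      field_simp
      ring

theorem linear_tail (hs : SubGaussianSample μ X e T C)
    {h : EuclideanSpace ℝ (Fin d) → ℝ} (hm : Measurable h) {η : ℝ} (hη : 0 < η)
    (hh : ∀ x, ‖x‖ ≤ T → |h x| ≤ η) {n : ℕ} (hn : 0 < n) {t : ℝ} (ht : 0 ≤ t) :
    μ.real {ω | t ≤ |∑ i ∈ Finset.range n, h (X i ω) * e i ω|} ≤
      2 * Real.exp (-(t ^ 2 / (4 * C * n * η ^ 2))) := by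
  have h1 := hs.linear_tail_one_sided hm hη hh hn ht
  have h2 := hs.linear_tail_one_sided hm.neg hη (fun x hx => by simpa using hh x hx) hn ht
  have hsub : {ω | t ≤ |∑ i ∈ Finset.range n, h (X i ω) * e i ω|} ⊆
      {ω | t ≤ ∑ i ∈ Finset.range n, h (X i ω) * e i ω} ∪
      {ω | t ≤ ∑ i ∈ Finset.range n, (-h) (X i ω) * e i ω} := by
    intro ω hω
    rcases le_abs.1 (Set.mem_ofPred_eq ▸ hω) with h | h
    · exact Or.inl h
    · right
      simpa using h
  calc _ ≤ _ := measureReal_mono hsub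
    _ ≤ _ := measureReal_union_le _ _
    _ ≤ _ := by linarith

/-- The quadratic drift `-h² / 2` beats the noise: the offset sum is not above a fraction of its
mean, except with a probability exponentially small in `n E h(X)²`. -/
theorem offset_tail (hs : SubGaussianSample μ X e T C)
    {h : EuclideanSpace ℝ (Fin d) → ℝ} (hm : Measurable h) {M : ℝ}
    (hh : ∀ x, ‖x‖ ≤ T → |h x| ≤ M) {l : ℝ} (hl : 0 < l) (hlC : 16 * C * l ≤ 1)
    (hlM : l * M ^ 2 ≤ 4) (n : ℕ) :
    μ.real {ω | -(n / 16 * ∫ ω, h (X 0 ω) ^ 2 ∂μ) ≤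
        ∑ i ∈ Finset.range n, (2 * (h (X i ω) * e i ω) - h (X i ω) ^ 2 / 2)} ≤
      Real.exp (-(l / 16 * n * ∫ ω, h (X 0 ω) ^ 2 ∂μ)) := by
  set I := ∫ ω, h (X 0 ω) ^ 2 ∂μ with hI
  have hX := hs.measurable_covariate 0
  have hsq : ∀ x, ‖x‖ ≤ T → h x ^ 2 ≤ M ^ 2 := fun x hx => by
    rw [← sq_abs]; exact pow_le_pow_left₀ (abs_nonneg _) (hh x hx) 2
  have hc : ∀ x, ‖x‖ ≤ T → |2 * l * h x| ≤ 2 * l * M + l * M ^ 2 ∧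
      |l * h x ^ 2 / 2| ≤ 2 * l * M + l * M ^ 2 := fun x hx => by
    have hM : 0 ≤ M := (abs_nonneg _).trans (hh x hx)
    have h1 := mul_le_mul_of_nonneg_left (hsq x hx) hl.le
    have h0 : 0 ≤ l * h x ^ 2 := by positivity
    have h3 : 0 ≤ 2 * l * M := by positivity
    constructor
    · rw [abs_mul, abs_of_pos (by positivity : 0 < 2 * l)]
      have := mul_le_mul_of_nonneg_left (hh x hx) (by positivity : 0 ≤ 2 * l)
      linarith
    · rw [abs_of_nonneg (by positivity)]
      linarith
  have hi : Integrable (fun ω => h (X 0 ω) ^ 2) μ := by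
    refine Integrable.of_bound ((hm.comp hX).pow_const 2).aestronglyMeasurable (M ^ 2) ?_
    filter_upwards [hs.norm_le] with ω hω
    rw [Real.norm_eq_abs, abs_of_nonneg (sq_nonneg _)]
    exact hsq _ hω
  have h1 := hs.tail (a := fun x => 2 * l * h x) (b := fun x => l * h x ^ 2 / 2) (by fun_prop)
    (by fun_prop) hc n (l * -(n / 16 * I))
  have e1 : {ω | l * -(n / 16 * I) ≤
        ∑ i ∈ Finset.range n, (2 * l * h (X i ω) * e i ω - l * h (X i ω) ^ 2 / 2)} =
      {ω | -(n / 16 * I) ≤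
        ∑ i ∈ Finset.range n, (2 * (h (X i ω) * e i ω) - h (X i ω) ^ 2 / 2)} := by
    ext ω
    have : ∑ i ∈ Finset.range n, (2 * l * h (X i ω) * e i ω - l * h (X i ω) ^ 2 / 2) =
        l * ∑ i ∈ Finset.range n, (2 * (h (X i ω) * e i ω) - h (X i ω) ^ 2 / 2) := by
      rw [Finset.mul_sum]
      exact Finset.sum_congr rfl fun i _ => by ring
    simp only [this, Set.mem_ofPred_eq]
    exact mul_le_mul_iff_right₀ hl
  rw [e1] at h1
  have h2 : ∫ ω, Real.exp (C * (2 * l * h (X 0 ω)) ^ 2 - l * h (X 0 ω) ^ 2 / 2) ∂μ ≤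
      Real.exp (-(l / 8 * I)) := by
    calc _ ≤ ∫ ω, (1 - l / 8 * h (X 0 ω) ^ 2) ∂μ := by
          refine integral_mono_of_nonneg (Filter.Eventually.of_forall fun ω => (Real.exp_pos _).le)
            ((integrable_const 1).sub (hi.const_mul _)) ?_
          filter_upwards [hs.norm_le] with ω hω
          set y := h (X 0 ω) ^ 2 with hy
          have hy0 : 0 ≤ y := sq_nonneg _
          have hy1 : l / 4 * y ≤ 1 := by nlinarith [hsq _ hω]
          have hexp : C * (2 * l * h (X 0 ω)) ^ 2 - l * y / 2 ≤ l / 4 * y * (-1) := by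
            have : C * (2 * l * h (X 0 ω)) ^ 2 = (16 * C * l) * (l / 4 * y) := by rw [hy]; ring
            rw [this]
            nlinarith [mul_le_mul_of_nonneg_right hlC (by positivity : 0 ≤ l / 4 * y)]
          have hch := exp_mul_le_chord (z := -1) (by positivity : 0 ≤ l / 4 * y) hy1
          have := mul_le_mul_of_nonneg_left exp_neg_one_le_half (by positivity : 0 ≤ l / 4 * y)
          linarith [Real.exp_le_exp.2 hexp]
      _ = -(l / 8 * I) + 1 := by
          rw [integral_sub (integrable_const 1) (hi.const_mul _), integral_const_mul]
          simp [hI]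
          ring
      _ ≤ _ := Real.add_one_le_exp _
  calc _ ≤ _ := h1
    _ ≤ Real.exp (-(l * -(n / 16 * I))) * Real.exp (-(l / 8 * I)) ^ n := by
      gcongr
    _ = _ := by
      rw [← Real.exp_nat_mul, ← Real.exp_add]
      congr 1
      ring

/-! ### Chaining -/

/-- Chaining along nets of resolution `(q 2ᵏ)⁻²` with entropy `A q 2ᵏ`, for `n = q⁵`: passing from a
function of the class to its approximation in the net of resolution `q⁻² = n^(-2/5)` changes the
noise term by `O(q) = O(n · n^(-4/5))`, uniformly over the class. -/
theorem exists_chaining_event (hs : SubGaussianSample μ X e T C)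
    {G : Set (EuclideanSpace ℝ (Fin d) → ℝ)} (hG : ∀ g ∈ G, Measurable g)
    {N : ℝ → Finset (EuclideanSpace ℝ (Fin d) → ℝ)} {A : ℝ} (hA : 0 ≤ A)
    (hN : ∀ κ, 1 ≤ κ → (N κ : Set _) ⊆ G ∧ ((N κ).card : ℝ) ≤ Real.exp (A * κ) ∧
      ∀ g ∈ G, ∃ g' ∈ N κ, ∀ x, ‖x‖ ≤ T → |g x - g' x| ≤ 1 / κ ^ 2)
    {Q : ℝ} (hQ : 1 ≤ Q) {n : ℕ} {q : ℝ} (hq : 1 ≤ q) (hqn : q ^ 5 = n) :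
    ∃ bad : Set Ω, μ bad ≤ ENNReal.ofReal (4 * Real.exp (-Q)) ∧
      ∀ ω, ω ∉ bad → (∀ i, ‖X i ω‖ ≤ T) → ∀ g ∈ G, ∃ γ ∈ N q,
        (∀ x, ‖x‖ ≤ T → |g x - γ x| ≤ 1 / q ^ 2) ∧
        |∑ i ∈ Finset.range n, (g (X i ω) - γ (X i ω)) * e i ω| ≤
          2 * (Real.sqrt (16 * C * (3 * A + Q)) * q) := by
  have hC := hs.pos
  have hq0 : 0 < q := by linarith
  have hn' : (0 : ℝ) < n := by rw [← hqn]; positivity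
  have hn : 0 < n := by exact_mod_cast hn'
  set B := Real.sqrt (16 * C * (3 * A + Q)) with hB
  have hB2 : B ^ 2 = 16 * C * (3 * A + Q) := Real.sq_sqrt (by positivity)
  have hB0 : 0 ≤ B := Real.sqrt_nonneg _
  have hκ : ∀ k : ℕ, 1 ≤ q * 2 ^ k := fun k =>
    one_le_mul_of_one_le_of_one_le hq (one_le_pow₀ one_le_two)
  let bad : ℕ → Set Ω := fun k => ⋃ γ ∈ N (q * 2 ^ k), ⋃ γ' ∈ N (q * 2 ^ (k + 1)),
    {ω | (∀ x, ‖x‖ ≤ T → |γ x - γ' x| ≤ 2 * (1 / (q * 2 ^ k) ^ 2)) ∧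
      B * q / 2 ^ k ≤ |∑ i ∈ Finset.range n, (γ (X i ω) - γ' (X i ω)) * e i ω|}
  have hbad : ∀ k, μ (bad k) ≤ ENNReal.ofReal (4 * Real.exp (-Q) * (1 / 2 * (1 / 2) ^ k)) := by
    intro k
    obtain ⟨hN1, hN2, -⟩ := hN _ (hκ k)
    obtain ⟨hN1', hN2', -⟩ := hN _ (hκ (k + 1))
    set τ := 2 * Real.exp (-((3 * A + Q) * q * 4 ^ k)) with hτ
    have hpair : ∀ γ ∈ N (q * 2 ^ k), ∀ γ' ∈ N (q * 2 ^ (k + 1)),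
        μ.real {ω | (∀ x, ‖x‖ ≤ T → |γ x - γ' x| ≤ 2 * (1 / (q * 2 ^ k) ^ 2)) ∧
          B * q / 2 ^ k ≤ |∑ i ∈ Finset.range n, (γ (X i ω) - γ' (X i ω)) * e i ω|} ≤ τ := by
      intro γ hγ γ' hγ'
      by_cases hd : ∀ x, ‖x‖ ≤ T → |γ x - γ' x| ≤ 2 * (1 / (q * 2 ^ k) ^ 2)
      · have := hs.linear_tail (h := fun x => γ x - γ' x)
          ((hG _ (hN1 hγ)).sub (hG _ (hN1' hγ'))) (by positivity) hd hn
          (by positivity : 0 ≤ B * q / 2 ^ k)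
        refine (measureReal_mono fun ω hω => hω.2).trans (this.trans (le_of_eq ?_))
        rw [hτ]
        congr 3
        rw [← hqn, div_pow, mul_pow, hB2]
        have h4 : (4 : ℝ) ^ k = 2 ^ k * 2 ^ k := by rw [← mul_pow]; norm_num
        rw [h4]
        field_simp
        ring
      · simp only [hd, false_and, Set.ofPred_false, measureReal_empty]
        positivity
    have hreal : μ.real (bad k) ≤ (N (q * 2 ^ k)).card * ((N (q * 2 ^ (k + 1))).card * τ) := by
      refine (measureReal_biUnion_finset_le _ _).trans ?_
      rw [← nsmul_eq_mul]
      refine Finset.sum_le_card_nsmul _ _ _ fun γ hγ => ?_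
      refine (measureReal_biUnion_finset_le _ _).trans ?_
      rw [← nsmul_eq_mul]
      exact Finset.sum_le_card_nsmul _ _ _ fun γ' hγ' => hpair γ hγ γ' hγ'
    have h4k : (2 : ℝ) ^ k ≤ 4 ^ k := pow_le_pow_left₀ (by norm_num) (by norm_num) k
    have hk1 : (k : ℝ) + 1 ≤ q * 4 ^ k := by
      have h1 : (k : ℝ) + 1 ≤ 2 ^ k := by exact_mod_cast Nat.lt_two_pow_self (n := k)
      nlinarith [pow_pos (by norm_num : (0 : ℝ) < 4) k]
    have hexp1 := exp_neg_one_le_half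
    have hle : μ.real (bad k) ≤ 4 * Real.exp (-Q) * (1 / 2 * (1 / 2) ^ k) := by
      calc μ.real (bad k) ≤ _ := hreal
        _ ≤ Real.exp (A * (q * 2 ^ k)) * (Real.exp (A * (q * 2 ^ (k + 1))) * τ) := by gcongr
        _ = 2 * Real.exp (3 * A * q * 2 ^ k - (3 * A + Q) * q * 4 ^ k) := by
          rw [hτ, mul_left_comm _ 2, mul_left_comm _ 2, ← Real.exp_add, ← Real.exp_add]
          congr 2
          ring
        _ ≤ 2 * Real.exp (-Q + k * (-1)) := by
          gcongr
          have h1 : 3 * A * q * 2 ^ k ≤ 3 * A * q * 4 ^ k := by gcongr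
          have h2 : Q * (k + 1) ≤ Q * (q * 4 ^ k) := by gcongr
          have h3 : (k : ℝ) * 1 ≤ k * Q := by gcongr
          linarith
        _ = 2 * (Real.exp (-Q) * Real.exp (-1) ^ k) := by
          rw [Real.exp_add, Real.exp_nat_mul]
        _ ≤ 2 * (Real.exp (-Q) * (1 / 2) ^ k) := by gcongr
        _ = _ := by ring
    rw [← ofReal_measureReal (measure_ne_top μ _)]
    exact ENNReal.ofReal_le_ofReal hle
  refine ⟨⋃ k, bad k, ?_, ?_⟩
  · refine (measure_iUnion_le _).trans ((ENNReal.tsum_le_tsum hbad).trans ?_)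
    have hsum : HasSum (fun k : ℕ => 4 * Real.exp (-Q) * (1 / 2 * (1 / 2 : ℝ) ^ k))
        (4 * Real.exp (-Q)) := by
      have h := (hasSum_geometric_two.mul_left (1 / 2)).mul_left (4 * Real.exp (-Q))
      norm_num at h ⊢
      exact h
    rw [← ENNReal.ofReal_tsum_of_nonneg (fun k => by positivity) hsum.summable, hsum.tsum_eq]
  · intro ω hω hXω g hg
    have hπ : ∀ k : ℕ, ∃ γ ∈ N (q * 2 ^ k), ∀ x, ‖x‖ ≤ T → |g x - γ x| ≤ 1 / (q * 2 ^ k) ^ 2 :=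
      fun k => (hN _ (hκ k)).2.2 g hg
    choose π hπN hπd using hπ
    have hstep : ∀ k, dist (∑ i ∈ Finset.range n, π k (X i ω) * e i ω)
        (∑ i ∈ Finset.range n, π (k + 1) (X i ω) * e i ω) ≤ 2 * (B * q) / 2 / 2 ^ k := by
      intro k
      have hnot : ω ∉ bad k := fun h => hω (Set.mem_iUnion.2 ⟨k, h⟩)
      simp only [bad, Set.mem_iUnion, not_exists, Set.mem_ofPred_eq, not_and, not_le] at hnot
      have hd : ∀ x, ‖x‖ ≤ T → |π k x - π (k + 1) x| ≤ 2 * (1 / (q * 2 ^ k) ^ 2) := by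
        intro x hx
        have h1 := hπd k x hx
        have h2 := hπd (k + 1) x hx
        have h3 : 1 / (q * 2 ^ (k + 1)) ^ 2 ≤ 1 / (q * 2 ^ k) ^ 2 := by
          gcongr
          · norm_num
          · omega
        have h4 := abs_sub_le (π k x) (g x) (π (k + 1) x)
        rw [abs_sub_comm (π k x) (g x)] at h4
        linarith
      have h := hnot _ (hπN k) _ (hπN (k + 1)) hd
      rw [Real.dist_eq, ← Finset.sum_sub_distrib]
      simp only [← sub_mul]
      rw [mul_div_cancel_left₀ _ (two_ne_zero' ℝ)]
      exact h.le
    have hlim : Filter.Tendsto (fun k => ∑ i ∈ Finset.range n, π k (X i ω) * e i ω) Filter.atTop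
        (nhds (∑ i ∈ Finset.range n, g (X i ω) * e i ω)) := by
      refine tendsto_finsetSum _ fun i _ => Filter.Tendsto.mul_const _ ?_
      rw [tendsto_iff_dist_tendsto_zero]
      refine squeeze_zero (fun _ => dist_nonneg) (g := fun k : ℕ => (1 / 2 : ℝ) ^ k) (fun k => ?_)
        (tendsto_pow_atTop_nhds_zero_of_lt_one (by norm_num) (by norm_num))
      rw [Real.dist_eq, abs_sub_comm]
      refine (hπd k _ (hXω i)).trans ?_
      rw [div_pow, one_pow]
      have h1 : (2 : ℝ) ^ k ≤ q * 2 ^ k := le_mul_of_one_le_left (by positivity) hq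
      have h2 : q * 2 ^ k ≤ (q * 2 ^ k) ^ 2 := le_self_pow₀ (hκ k) two_ne_zero
      gcongr
      exact h1.trans h2
    have h := dist_le_of_le_geometric_two_of_tendsto₀ hstep hlim
    refine ⟨π 0, by simpa using hπN 0, fun x hx => by simpa using hπd 0 x hx, ?_⟩
    rw [dist_comm, Real.dist_eq, ← Finset.sum_sub_distrib] at h
    simpa only [← sub_mul] using h

end SubGaussianSample

/-! ### The rate for least squares over ridge functions -/

/-- Replacing `g` by an approximation `γ` costs half of the quadratic drift: `-(a + b)² ≤
-a² / 2 + b²` with `a = γ - f`, `b = g - γ`. -/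
theorem offset_split {g γ r : ℝ} (f e : ℝ) (h : (g - γ) ^ 2 ≤ r) :
    2 * ((g - f) * e) - (g - f) ^ 2 ≤
      2 * ((γ - f) * e) - (γ - f) ^ 2 / 2 + 2 * ((g - γ) * e) + r := by
  have h1 : 2 * ((γ - f) * e) - (γ - f) ^ 2 / 2 + 2 * ((g - γ) * e) + r -
      (2 * ((g - f) * e) - (g - f) ^ 2) = ((γ - f) + 2 * (g - γ)) ^ 2 / 2 + (r - (g - γ) ^ 2) := by
    ring
  have h2 : 0 ≤ ((γ - f) + 2 * (g - γ)) ^ 2 / 2 := by positivity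
  linarith

namespace SubGaussianSample

variable {Ω : Type*} [MeasurableSpace Ω] {μ : Measure Ω} [IsProbabilityMeasure μ] {d : ℕ}
  {X : ℕ → Ω → EuclideanSpace ℝ (Fin d)} {e : ℕ → Ω → ℝ} {T C : ℝ}

theorem integrable_sub_sq (hs : SubGaussianSample μ X e T C) {L : ℝ≥0} {M : ℝ}
    {g f : EuclideanSpace ℝ (Fin d) → ℝ} (hg : g ∈ ridgeClass d L M) (hf : f ∈ ridgeClass d L M) :
    Integrable (fun ω => (g (X 0 ω) - f (X 0 ω)) ^ 2) μ := by
  have hX := hs.measurable_covariate 0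
  have hgm := (continuous_of_mem_ridgeClass hg).measurable
  have hfm := (continuous_of_mem_ridgeClass hf).measurable
  refine Integrable.of_bound (((hgm.comp hX).sub (hfm.comp hX)).pow_const 2).aestronglyMeasurable
    ((M + L * T + (M + L * T)) ^ 2) ?_
  filter_upwards [hs.norm_le] with ω hω
  rw [norm_pow, Real.norm_eq_abs]
  refine pow_le_pow_left₀ (abs_nonneg _) ?_ 2
  exact (abs_sub _ _).trans
    (add_le_add (abs_le_of_mem_ridgeClass hg hω) (abs_le_of_mem_ridgeClass hf hω))

/-- Outside an event of small probability, every ridge function whose empirical risk does not exceed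
that of the regression function `f` is within `O(q⁻²) = O(n^(-2/5))` of `f` in `L²`. -/
theorem exists_rate_event (hs : SubGaussianSample μ X e T C) (hT : 0 ≤ T) {L : ℝ≥0} {M : ℝ}
    (hM : 0 ≤ M) {f : EuclideanSpace ℝ (Fin d) → ℝ} (hf : f ∈ ridgeClass d L M) {δ : ℝ}
    (hδ : 0 < δ) :
    ∃ R : ℝ, 0 < R ∧ ∀ (n : ℕ) (q : ℝ), 1 ≤ q → q ^ 5 = n →
      ∃ bad : Set Ω, μ bad ≤ ENNReal.ofReal δ ∧
        ∀ ω, ω ∉ bad → (∀ i, ‖X i ω‖ ≤ T) → ∀ g ∈ ridgeClass d L M,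
          0 ≤ ∑ i ∈ Finset.range n,
            (2 * ((g (X i ω) - f (X i ω)) * e i ω) - (g (X i ω) - f (X i ω)) ^ 2) →
          ∫ ω, (g (X 0 ω) - f (X 0 ω)) ^ 2 ∂μ ≤ R / q ^ 4 := by
  obtain ⟨A, hA, hnet⟩ := exists_ridge_net d L hM hT
  have hnet' : ∀ κ : ℝ, ∃ N : Finset (EuclideanSpace ℝ (Fin d) → ℝ), 1 ≤ κ →
      (N : Set _) ⊆ ridgeClass d L M ∧ (N.card : ℝ) ≤ Real.exp (A * κ) ∧
      ∀ g ∈ ridgeClass d L M, ∃ g' ∈ N, ∀ x, ‖x‖ ≤ T → |g x - g' x| ≤ 1 / κ ^ 2 := by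
    intro κ
    by_cases hκ : 1 ≤ κ
    · obtain ⟨N, hN⟩ := hnet κ hκ
      exact ⟨N, fun _ => hN⟩
    · exact ⟨∅, fun h => absurd h hκ⟩
  choose N hN using hnet'
  have hC := hs.pos
  set Q : ℝ := 8 / δ + 1 with hQ
  have hQ1 : 1 ≤ Q := by rw [hQ]; linarith [(by positivity : 0 ≤ 8 / δ)]
  have hexpQ : Real.exp (-Q) ≤ δ / 8 := by
    have h1 : 8 / δ ≤ Real.exp Q := by linarith [Real.add_one_le_exp Q]
    rw [Real.exp_neg, ← inv_div]
    exact inv_anti₀ (by positivity) h1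
  set B := Real.sqrt (16 * C * (3 * A + Q)) with hB
  have hB0 : 0 ≤ B := Real.sqrt_nonneg _
  set D : ℝ := M + L * T + (M + L * T) with hD
  have hD0 : 0 ≤ D := by positivity
  set l : ℝ := 1 / (16 * C + D ^ 2) with hl
  have hl0 : 0 < l := by positivity
  have hl1 : l * (16 * C + D ^ 2) = 1 := by rw [hl]; field_simp
  have hlC : 16 * C * l ≤ 1 := by nlinarith [sq_nonneg D]
  have hlD : l * D ^ 2 ≤ 4 := by nlinarith
  set R₀ : ℝ := 16 * (1 + 4 * B) + 16 * (A + Q) / l with hR₀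
  have hR0 : 0 ≤ 16 * (A + Q) / l := by positivity
  have hRB : 16 * (1 + 4 * B) ≤ R₀ := by linarith
  have hRl : 16 * (A + Q) ≤ R₀ * l := by
    have : 16 * (A + Q) / l * l = 16 * (A + Q) := by field_simp
    have : 0 ≤ 16 * (1 + 4 * B) * l := by positivity
    rw [hR₀, add_mul]
    linarith
  refine ⟨2 * R₀ + 2, by positivity, fun n q hq hqn => ?_⟩
  have hq0 : 0 < q := by linarith
  obtain ⟨bad₁, hbad₁, hchain⟩ := hs.exists_chaining_event
    (fun g hg => (continuous_of_mem_ridgeClass hg).measurable) hA hN hQ1 hq hqn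
  obtain ⟨hN1, hN2, -⟩ := hN q hq
  -- the event on which the offset bound fails for some net function far from `f`
  let bad₂ : Set Ω := ⋃ γ ∈ N q, {ω | R₀ / q ^ 4 ≤ ∫ ω, (γ (X 0 ω) - f (X 0 ω)) ^ 2 ∂μ ∧
    -(n / 16 * ∫ ω, (γ (X 0 ω) - f (X 0 ω)) ^ 2 ∂μ) ≤ ∑ i ∈ Finset.range n,
      (2 * ((γ (X i ω) - f (X i ω)) * e i ω) - (γ (X i ω) - f (X i ω)) ^ 2 / 2)}
  have hbad₂ : μ.real bad₂ ≤ Real.exp (-Q) := by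
    have hone : ∀ γ ∈ N q, μ.real {ω | R₀ / q ^ 4 ≤ ∫ ω, (γ (X 0 ω) - f (X 0 ω)) ^ 2 ∂μ ∧
        -(n / 16 * ∫ ω, (γ (X 0 ω) - f (X 0 ω)) ^ 2 ∂μ) ≤ ∑ i ∈ Finset.range n,
          (2 * ((γ (X i ω) - f (X i ω)) * e i ω) - (γ (X i ω) - f (X i ω)) ^ 2 / 2)} ≤
        Real.exp (-((A + Q) * q)) := by
      intro γ hγ
      by_cases hfar : R₀ / q ^ 4 ≤ ∫ ω, (γ (X 0 ω) - f (X 0 ω)) ^ 2 ∂μ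
      · have h := hs.offset_tail (h := fun x => γ x - f x) (M := D)
          ((continuous_of_mem_ridgeClass (hN1 hγ)).sub (continuous_of_mem_ridgeClass hf)).measurable
          (fun x hx => (abs_sub _ _).trans (add_le_add (abs_le_of_mem_ridgeClass (hN1 hγ) hx)
            (abs_le_of_mem_ridgeClass hf hx))) hl0 hlC hlD n
        refine (measureReal_mono fun ω hω => hω.2).trans (h.trans (Real.exp_le_exp.2 ?_))
        refine neg_le_neg ?_
        calc (A + Q) * q ≤ R₀ * l / 16 * q := by gcongr; linarith
          _ = l / 16 * n * (R₀ / q ^ 4) := by rw [← hqn]; field_simp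
          _ ≤ _ := by gcongr
      · simp only [hfar, false_and, Set.ofPred_false, measureReal_empty]
        positivity
    calc μ.real bad₂ ≤ ∑ γ ∈ N q, _ := measureReal_biUnion_finset_le _ _
      _ ≤ (N q).card • Real.exp (-((A + Q) * q)) := Finset.sum_le_card_nsmul _ _ _ hone
      _ ≤ Real.exp (A * q) * Real.exp (-((A + Q) * q)) := by rw [nsmul_eq_mul]; gcongr
      _ = Real.exp (-(Q * q)) := by rw [← Real.exp_add]; congr 1; ring
      _ ≤ Real.exp (-Q) := Real.exp_le_exp.2 (by nlinarith)
  refine ⟨bad₁ ∪ bad₂, ?_, ?_⟩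
  · have h2 : μ bad₂ ≤ ENNReal.ofReal (Real.exp (-Q)) := by
      rw [← ofReal_measureReal (measure_ne_top μ _)]
      exact ENNReal.ofReal_le_ofReal hbad₂
    refine (measure_union_le _ _).trans ((add_le_add hbad₁ h2).trans ?_)
    rw [← ENNReal.ofReal_add (by positivity) (by positivity)]
    exact ENNReal.ofReal_le_ofReal (by linarith)
  · intro ω hω hXω g hg hrisk
    rw [Set.mem_union, not_or] at hω
    obtain ⟨γ, hγ, hgγ, hlin⟩ := hchain ω hω.1 hXω g hg
    by_contra! hlarge
    have hγG := hN1 hγ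
    have hint := hs.integrable_sub_sq hγG hf
    have hfar : R₀ / q ^ 4 < ∫ ω, (γ (X 0 ω) - f (X 0 ω)) ^ 2 ∂μ := by
      have h1 : ∫ ω, (g (X 0 ω) - f (X 0 ω)) ^ 2 ∂μ ≤
          ∫ ω, (2 * (γ (X 0 ω) - f (X 0 ω)) ^ 2 + 2 * (1 / q ^ 2) ^ 2) ∂μ := by
        refine integral_mono_ae (hs.integrable_sub_sq hg hf)
          ((hint.const_mul 2).add (integrable_const _)) ?_
        filter_upwards [hs.norm_le] with ω' hω'
        have h2 := pow_le_pow_left₀ (abs_nonneg _) (hgγ _ hω') 2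
        rw [sq_abs] at h2
        nlinarith [sq_nonneg ((γ (X 0 ω') - f (X 0 ω')) - (g (X 0 ω') - γ (X 0 ω')))]
      rw [integral_add (hint.const_mul 2) (integrable_const _), integral_const_mul] at h1
      simp only [integral_const, probReal_univ, one_smul] at h1
      have e1 : 2 * (1 / q ^ 2) ^ 2 = 2 * (1 / q ^ 4) := by rw [div_pow, one_pow, ← pow_mul]
      have e2 : (2 * R₀ + 2) / q ^ 4 = 2 * (R₀ / q ^ 4) + 2 * (1 / q ^ 4) := by ring
      rw [e1] at h1
      rw [e2] at hlarge
      linarith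
    have hoff : ∑ i ∈ Finset.range n,
        (2 * ((γ (X i ω) - f (X i ω)) * e i ω) - (γ (X i ω) - f (X i ω)) ^ 2 / 2) <
        -(n / 16 * ∫ ω, (γ (X 0 ω) - f (X 0 ω)) ^ 2 ∂μ) := by
      have := hω.2
      simp only [bad₂, Set.mem_iUnion, not_exists, Set.mem_ofPred_eq, not_and, not_le] at this
      exact this γ hγ hfar.le
    have hdrift : (R₀ / 16) * q ≤ n / 16 * ∫ ω, (γ (X 0 ω) - f (X 0 ω)) ^ 2 ∂μ := by
      calc (R₀ / 16) * q = n / 16 * (R₀ / q ^ 4) := by rw [← hqn]; field_simp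
        _ ≤ _ := by gcongr
    have hsplit : ∑ i ∈ Finset.range n,
          (2 * ((g (X i ω) - f (X i ω)) * e i ω) - (g (X i ω) - f (X i ω)) ^ 2) ≤
        ∑ i ∈ Finset.range n,
          (2 * ((γ (X i ω) - f (X i ω)) * e i ω) - (γ (X i ω) - f (X i ω)) ^ 2 / 2) +
        2 * ∑ i ∈ Finset.range n, (g (X i ω) - γ (X i ω)) * e i ω + q := by
      have hq' : q = ∑ i ∈ Finset.range n, 1 / q ^ 4 := by
        rw [Finset.sum_const, Finset.card_range, nsmul_eq_mul, ← hqn]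
        field_simp
      conv_rhs => rw [hq']
      rw [Finset.mul_sum, ← Finset.sum_add_distrib, ← Finset.sum_add_distrib]
      refine Finset.sum_le_sum fun i _ => ?_
      have h2 := pow_le_pow_left₀ (abs_nonneg _) (hgγ _ (hXω i)) 2
      rw [sq_abs, div_pow, one_pow, ← pow_mul] at h2
      exact offset_split (f (X i ω)) (e i ω) h2
    have hl2 := (abs_le.1 hlin).2
    have : 16 * (1 + 4 * B) * q ≤ R₀ * q := by gcongr
    linarith

/-- Empirical second moment of the noise: Markov's inequality. -/
theorem exists_noise_bound (hs : SubGaussianSample μ X e T C)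
    (hint : Integrable (fun ω => e 0 ω ^ 2) μ) {δ : ℝ} (hδ : 0 < δ) :
    ∃ V : ℝ, 0 ≤ V ∧ ∀ n : ℕ, 1 ≤ n →
      μ {ω | n * V ≤ ∑ i ∈ Finset.range n, e i ω ^ 2} ≤ ENNReal.ofReal δ := by
  set σ := ∫ ω, e 0 ω ^ 2 ∂μ with hσ
  have hσ0 : 0 ≤ σ := integral_nonneg fun ω => sq_nonneg _
  refine ⟨(σ + 1) / δ, by positivity, fun n hn => ?_⟩
  have hn' : (0 : ℝ) < n := by exact_mod_cast hn
  have hid : ∀ i, IdentDistrib (fun ω => e i ω ^ 2) (fun ω => e 0 ω ^ 2) μ μ := fun i =>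
    (hs.ident i).comp (u := fun z : EuclideanSpace ℝ (Fin d) × ℝ => z.2 ^ 2) (by fun_prop)
  have hinti : ∀ i, Integrable (fun ω => e i ω ^ 2) μ := fun i => (hid i).integrable_iff.2 hint
  have h := mul_meas_ge_le_integral_of_nonneg (μ := μ)
    (f := fun ω => ∑ i ∈ Finset.range n, e i ω ^ 2)
    (Filter.Eventually.of_forall fun ω => Finset.sum_nonneg fun i _ => sq_nonneg _)
    (integrable_finsetSum _ fun i _ => hinti i) (n * ((σ + 1) / δ))
  rw [integral_finsetSum _ fun i _ => hinti i,
    Finset.sum_congr rfl fun i _ => (hid i).integral_eq, Finset.sum_const, Finset.card_range,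
    nsmul_eq_mul, ← hσ] at h
  rw [← ofReal_measureReal (measure_ne_top μ _)]
  refine ENNReal.ofReal_le_ofReal ?_
  set p := μ.real {ω | n * ((σ + 1) / δ) ≤ ∑ i ∈ Finset.range n, e i ω ^ 2}
  have h1 : (σ + 1) / δ * p ≤ σ := by
    rw [mul_assoc] at h
    exact le_of_mul_le_mul_left h hn'
  have h2 : (σ + 1) * p ≤ σ * δ := by
    have : (σ + 1) * p = (σ + 1) / δ * p * δ := by field_simp
    rw [this]; gcongr
  by_contra! h3
  nlinarith

end SubGaussianSample

theorem mem_indexDomain {d : ℕ} [NeZero d] {χ : Set (EuclideanSpace ℝ (Fin d))}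
    {θ x : EuclideanSpace ℝ (Fin d)} (hθ : θ ∈ indexSet d) (hx : x ∈ χ) :
    inner ℝ θ x ∈ indexDomain χ := ⟨θ, hθ, x, hx, rfl⟩

theorem sq_le_mul_exp_sub_one {K : ℝ} (hK : 0 < K) (t : ℝ) :
    t ^ 2 ≤ K * (Real.exp (t ^ 2 / K) - 1) := by
  have h := mul_le_mul_of_nonneg_left (Real.add_one_le_exp (t ^ 2 / K)) hK.le
  have e1 : K * (t ^ 2 / K + 1) = t ^ 2 + K := by field_simp
  linarith

/-- With `h = g - f` at the design points, a candidate `g` whose risk does not exceed that of `f`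
is close to `f` at one design point, up to the size of the noise. -/
theorem exists_abs_le_of_risk_le {n : ℕ} (hn : 1 ≤ n) {h e : ℕ → ℝ} {V : ℝ} (hV : 0 ≤ V)
    (hrisk : 0 ≤ ∑ i ∈ Finset.range n, (2 * (h i * e i) - h i ^ 2))
    (he : ∑ i ∈ Finset.range n, e i ^ 2 ≤ n * V) :
    ∃ i, |h i| ≤ 2 * Real.sqrt V := by
  have h1 : ∑ i ∈ Finset.range n, h i ^ 2 ≤ ∑ i ∈ Finset.range n, 4 * V := by
    have h2 : ∑ i ∈ Finset.range n, (2 * (h i * e i) - h i ^ 2) ≤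
        ∑ i ∈ Finset.range n, (2 * e i ^ 2 - 1 / 2 * h i ^ 2) :=
      Finset.sum_le_sum fun i _ => by nlinarith [sq_nonneg (h i - 2 * e i)]
    rw [Finset.sum_sub_distrib, Finset.sum_sub_distrib, ← Finset.mul_sum, ← Finset.mul_sum,
      ← Finset.mul_sum] at h2
    rw [Finset.sum_sub_distrib, ← Finset.mul_sum] at hrisk
    rw [Finset.sum_const, Finset.card_range, nsmul_eq_mul]
    linarith
  obtain ⟨i, -, hi⟩ := Finset.exists_le_of_sum_le
    (Finset.nonempty_range_iff.2 (by omega)) h1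
  refine ⟨i, abs_le_of_sq_le_sq ?_ (by positivity)⟩
  rw [mul_pow, Real.sq_sqrt hV]
  linarith

theorem eLpNorm_two_le_of_integral_sq_le {E : Type*} [MeasurableSpace E] {P : Measure E}
    {h : E → ℝ} (hm : AEStronglyMeasurable h P) (hi : Integrable (fun x => h x ^ 2) P) {c : ℝ}
    (hc : 0 ≤ c) (hle : ∫ x, h x ^ 2 ∂P ≤ c ^ 2) : eLpNorm h 2 P ≤ ENNReal.ofReal c := by
  have hL : MemLp h 2 P := (memLp_two_iff_integrable_sq hm).2 hi
  rw [hL.eLpNorm_eq_integral_rpow_norm two_ne_zero ENNReal.ofNat_ne_top]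
  refine ENNReal.ofReal_le_ofReal ?_
  simp only [ENNReal.toReal_ofNat, Real.rpow_two, Real.norm_eq_abs, sq_abs]
  rw [← one_div, ← Real.sqrt_eq_rpow]
  exact (Real.sqrt_le_sqrt hle).trans (Real.sqrt_sq hc).le

end CvxSIM

theorem mainTheorem3 {Ω : Type*} [MeasurableSpace Ω] (μ : Measure Ω) [IsProbabilityMeasure μ]
    (d : ℕ) [NeZero d]
    -- i.i.d. data from the single index model
    (X : ℕ → Ω → EuclideanSpace ℝ (Fin d)) (Y ε : ℕ → Ω → ℝ)
    (m₀ : ℝ → ℝ) (θ₀ : EuclideanSpace ℝ (Fin d)) (hθ₀ : θ₀ ∈ CvxSIM.indexSet d)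
    (hX : ∀ i, Measurable (X i)) (hY : ∀ i, Measurable (Y i))
    (hindep : iIndepFun (fun i ω => (X i ω, Y i ω)) μ)
    (hident : ∀ i, IdentDistrib (fun ω => (X i ω, Y i ω)) (fun ω => (X 0 ω, Y 0 ω)) μ μ)
    (hmodel : ∀ i, ∀ᵐ ω ∂μ, Y i ω = m₀ (inner ℝ θ₀ (X i ω)) + ε i ω)
    -- the law of `X`, its support, and the set `D`
    (P : Measure (EuclideanSpace ℝ (Fin d))) (hP : P = μ.map (X 0))
    (χ : Set (EuclideanSpace ℝ (Fin d))) (hχ : χ = P.support)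
    (D : Set ℝ) (hD : D = CvxSIM.indexDomain χ)
    -- (A1)
    (T : ℝ) (hA1 : IsCompact χ ∧ ∀ x ∈ χ, ‖x‖ ≤ T)
    -- (A2)
    (hA2 : CvxSIM.CondSubGaussian μ (X 0) (ε 0)) (hmean : CvxSIM.CondMeanZero μ (X 0) (ε 0))
    -- (L1)
    (M₀ : ℝ) (L₀ : ℝ≥0) (hM₀ : 1 ≤ M₀) (hconv : CvxSIM.ConvexFunOn D m₀)
    (hbdd : ∀ t ∈ D, |m₀ t| ≤ M₀) (hLip : LipschitzOnWith L₀ m₀ D)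
    -- (A3)
    (m₀' : ℝ → ℝ) (hm₀' : CvxSIM.IsRightDerivOn D L₀ m₀ m₀')
    (hA3 : IsUnit (CvxSIM.weightedSecondMoment P m₀' θ₀))
    -- (A4)
    (hA4 : (CvxSIM.covMatrix P).PosDef)
    -- the estimator, for sample size `n`
    (L : ℝ≥0) (hL : L₀ ≤ L)
    (m_est : ℕ → Ω → ℝ → ℝ) (θ_est : ℕ → Ω → EuclideanSpace ℝ (Fin d))
    (hest : ∀ n, 1 ≤ n → ∀ᵐ ω ∂μ,
      CvxSIM.IsLLSE D L n (fun i => X i ω) (fun i => Y i ω) (m_est n ω) (θ_est n ω)) :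
    CvxSIM.IsBigOInProb μ
      (fun n ω => CvxSIM.compDist P (m_est n ω) (θ_est n ω) m₀ θ₀)
      (fun n => (n : ℝ) ^ (-(2 / 5) : ℝ)) := by
  have hm₀class : m₀ ∈ CvxSIM.lipConvexClass D L := ⟨hconv, hLip.weaken hL⟩
  obtain ⟨f₀, hf₀c, hf₀L, hf₀eq⟩ := hconv.exists_extension (hLip.weaken hL)
  set f : EuclideanSpace ℝ (Fin d) → ℝ := fun x => f₀ (inner ℝ θ₀ x) with hf
  have hfm : Measurable f := (hf₀L.continuous.comp (by fun_prop)).measurable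
  have hDmem : ∀ θ ∈ CvxSIM.indexSet d, ∀ x ∈ χ, inner ℝ θ x ∈ D := fun θ hθ x hx => by
    rw [hD]; exact CvxSIM.mem_indexDomain hθ hx
  have hPχ : ∀ᵐ x ∂P, x ∈ χ := by rw [hχ]; exact P.support_mem_ae
  have hXχ : ∀ i, ∀ᵐ ω ∂μ, X i ω ∈ χ := fun i => by
    have hid : IdentDistrib (X i) (X 0) μ μ := (hident i).comp measurable_fst
    refine ae_of_ae_map (hX i).aemeasurable ?_
    rw [hid.map_eq, ← hP]
    exact hPχ
  -- the noise, as a measurable function of the observations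
  set e : ℕ → Ω → ℝ := fun i ω => Y i ω - f (X i ω) with he
  have hem : ∀ i, Measurable (e i) := fun i => (hY i).sub (hfm.comp (hX i))
  have heε : e 0 =ᵐ[μ] ε 0 := by
    filter_upwards [hmodel 0, hXχ 0] with ω h1 h2
    simp only [he, hf]
    rw [h1, hf₀eq (hDmem _ hθ₀ _ h2)]
    ring
  obtain ⟨K, hK, hKint, hKsub⟩ := hA2
  have hexp : (fun ω => Real.exp (e 0 ω ^ 2 / K) - 1) =ᵐ[μ]
      fun ω => Real.exp (ε 0 ω ^ 2 / K) - 1 := by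
    filter_upwards [heε] with ω h
    rw [h]
  have hint : Integrable (fun ω => Real.exp (e 0 ω ^ 2 / K) - 1) μ := hKint.congr hexp.symm
  set T' := max T 0 with hT'
  have hnorm : ∀ x ∈ χ, ‖x‖ ≤ T' := fun x hx => (hA1.2 x hx).trans (le_max_left _ _)
  have hs : CvxSIM.SubGaussianSample μ X e T' (1 + K / 2) := by
    have hφ : Measurable fun z : EuclideanSpace ℝ (Fin d) × ℝ => (z.1, z.2 - f z.1) := by fun_prop
    have hball : ∀ᵐ ω ∂μ, ‖X 0 ω‖ ≤ T' := (hXχ 0).mono fun ω h => hnorm _ h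
    refine ⟨hX, hem, hindep.comp (fun _ => _) (fun _ => hφ), fun i => (hident i).comp hφ, hball,
      by positivity, fun a b ha hb c hc => ?_⟩
    refine CvxSIM.integral_exp_le_of_condSubGaussian (hX 0) (hem 0) (hmean.1.congr heε.symm)
      ((condExp_congr_ae heε).trans hmean.2) hK hint ?_ ha hb
      (hball.mono fun ω h => (hc _ h).1) (hball.mono fun ω h => (hc _ h).2)
    filter_upwards [hKsub, condExp_congr_ae (m := MeasurableSpace.comap (X 0) inferInstance) hexp]
      with ω h1 h2
    rw [h2]
    exact h1
  have hsq : Integrable (fun ω => e 0 ω ^ 2) μ := by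
    refine (hint.const_mul K).mono' ((hem 0).pow_const 2).aestronglyMeasurable
      (Filter.Eventually.of_forall fun ω => ?_)
    rw [Real.norm_eq_abs, abs_of_nonneg (sq_nonneg _)]
    exact CvxSIM.sq_le_mul_exp_sub_one hK _
  intro δ hδ
  obtain ⟨V, hV, hnoise⟩ := hs.exists_noise_bound hsq (half_pos hδ)
  -- the bound on `m(0)` for the estimated profile when the noise has empirical variance at most `V`
  set M : ℝ := |f₀ 0| + 2 * (L * T') + 2 * Real.sqrt V with hM
  have hT'0 : 0 ≤ T' := le_max_right _ _
  have hM0 : 0 ≤ M := by positivity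
  have hfG : f ∈ CvxSIM.ridgeClass d L M := by
    refine ⟨f₀, θ₀, hf₀c, hf₀L, ?_, hθ₀.1.le, rfl⟩
    have : 0 ≤ 2 * (L * T') + 2 * Real.sqrt V := by positivity
    linarith
  obtain ⟨R, hR, hrate⟩ := hs.exists_rate_event hT'0 hM0 hfG (half_pos hδ)
  refine ⟨Real.sqrt R, Real.sqrt_pos.2 hR, fun n hn => ?_⟩
  have hn1 : (1 : ℝ) ≤ n := by exact_mod_cast hn
  set q : ℝ := (n : ℝ) ^ (1 / 5 : ℝ) with hq
  have hq1 : 1 ≤ q := Real.one_le_rpow hn1 (by norm_num)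
  have hqn : q ^ 5 = n := by
    rw [hq, ← Real.rpow_natCast, ← Real.rpow_mul (by positivity)]
    norm_num
  have hrn : (n : ℝ) ^ (-(2 / 5) : ℝ) = 1 / q ^ 2 := by
    rw [hq, ← Real.rpow_natCast, ← Real.rpow_mul (by positivity), one_div,
      ← Real.rpow_neg (by positivity)]
    norm_num
  obtain ⟨bad, hbad, hgood⟩ := hrate n q hq1 hqn
  have hae : ∀ᵐ ω ∂μ, (∀ i, X i ω ∈ χ) ∧ CvxSIM.IsLLSE D L n (fun i => X i ω) (fun i => Y i ω)
      (m_est n ω) (θ_est n ω) := (ae_all_iff.2 hXχ).and (hest n hn)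
  have hsub : {ω | ENNReal.ofReal (Real.sqrt R * (n : ℝ) ^ (-(2 / 5) : ℝ)) <
      CvxSIM.compDist P (m_est n ω) (θ_est n ω) m₀ θ₀} ≤ᵐ[μ]
      ({ω | n * V ≤ ∑ i ∈ Finset.range n, e i ω ^ 2} ∪ bad : Set Ω) := by
    filter_upwards [hae] with ω ⟨hXω, hls⟩ hω
    by_contra hnot
    replace hnot : ω ∉ ({ω | n * V ≤ ∑ i ∈ Finset.range n, e i ω ^ 2} ∪ bad : Set Ω) := hnot
    rw [Set.mem_union, not_or] at hnot
    obtain ⟨hV', hbad'⟩ := hnot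
    refine absurd (show ENNReal.ofReal (Real.sqrt R * (n : ℝ) ^ (-(2 / 5) : ℝ)) <
      CvxSIM.compDist P (m_est n ω) (θ_est n ω) m₀ θ₀ from hω) (not_lt.2 ?_)
    have hθ := hls.mem_index
    obtain ⟨g₀, hg₀c, hg₀L, hg₀eq⟩ := hls.mem_class.1.exists_extension hls.mem_class.2
    set g : EuclideanSpace ℝ (Fin d) → ℝ := fun x => g₀ (inner ℝ (θ_est n ω) x) with hg
    have hgχ : ∀ x ∈ χ, m_est n ω (inner ℝ (θ_est n ω) x) = g x := fun x hx =>
      (hg₀eq (hDmem _ hθ _ hx)).symm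
    have hfχ : ∀ x ∈ χ, m₀ (inner ℝ θ₀ x) = f x := fun x hx => (hf₀eq (hDmem _ hθ₀ _ hx)).symm
    have hXT : ∀ i, ‖X i ω‖ ≤ T' := fun i => hnorm _ (hXω i)
    have hrisk : 0 ≤ ∑ i ∈ Finset.range n,
        (2 * ((g (X i ω) - f (X i ω)) * e i ω) - (g (X i ω) - f (X i ω)) ^ 2) := by
      have h1 := hls.minimizes m₀ hm₀class θ₀ hθ₀
      simp only [CvxSIM.leastSquares] at h1
      have h2 := le_of_mul_le_mul_left h1 (by positivity : (0 : ℝ) < 1 / n)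
      rw [← sub_nonneg, ← Finset.sum_sub_distrib] at h2
      refine h2.trans (le_of_eq (Finset.sum_congr rfl fun i _ => ?_))
      rw [hgχ _ (hXω i), hfχ _ (hXω i)]
      simp only [he]
      ring
    obtain ⟨i, hi⟩ := CvxSIM.exists_abs_le_of_risk_le hn
      (h := fun i => g (X i ω) - f (X i ω)) (e := fun i => e i ω) hV hrisk (not_le.1 hV').le
    have hgG : g ∈ CvxSIM.ridgeClass d L M := by
      refine ⟨g₀, θ_est n ω, hg₀c, hg₀L, ?_, hθ.1.le, rfl⟩
      have h1 : |f (X i ω)| ≤ |f₀ 0| + L * T' := CvxSIM.abs_le_of_lipschitz hf₀L le_rfl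
        (CvxSIM.abs_inner_le_of_norm_le_one hθ₀.1.le (hXT i))
      have h2 : |g₀ 0 - g (X i ω)| ≤ L * T' := by
        have h := hg₀L.dist_le_mul 0 (inner ℝ (θ_est n ω) (X i ω))
        rw [Real.dist_eq, Real.dist_eq, zero_sub, abs_neg] at h
        refine h.trans ?_
        gcongr
        exact CvxSIM.abs_inner_le_of_norm_le_one hθ.1.le (hXT i)
      have h3 : |g₀ 0| ≤ |g₀ 0 - g (X i ω)| + |g (X i ω) - f (X i ω)| + |f (X i ω)| := by
        have h4 := abs_add_three (g₀ 0 - g (X i ω)) (g (X i ω) - f (X i ω)) (f (X i ω))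
        rwa [sub_add_sub_cancel, sub_add_cancel] at h4
      linarith
    have hfin := hgood ω hbad' hXT g hgG hrisk
    have hcongr : CvxSIM.compDist P (m_est n ω) (θ_est n ω) m₀ θ₀ =
        eLpNorm (fun x => g x - f x) 2 P := by
      refine eLpNorm_congr_ae ?_
      filter_upwards [hPχ] with x hx
      rw [hgχ x hx, hfχ x hx]
    have hgfm : Measurable fun x => g x - f x :=
      (CvxSIM.continuous_of_mem_ridgeClass hgG).measurable.sub hfm
    have hintP : Integrable (fun x => (g x - f x) ^ 2) P := by
      rw [hP]
      exact (integrable_map_measure (hgfm.pow_const 2).aestronglyMeasurable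
        (hX 0).aemeasurable).2 (hs.integrable_sub_sq hgG hfG)
    rw [hcongr]
    refine CvxSIM.eLpNorm_two_le_of_integral_sq_le hgfm.aestronglyMeasurable hintP (by positivity) ?_
    have hmap : ∫ x, (g x - f x) ^ 2 ∂P = ∫ ω, (g (X 0 ω) - f (X 0 ω)) ^ 2 ∂μ := by
      rw [hP]
      exact integral_map (hX 0).aemeasurable (hgfm.pow_const 2).aestronglyMeasurable
    rw [hmap, hrn, mul_pow, Real.sq_sqrt hR.le, div_pow, one_pow, ← pow_mul, mul_one_div]
    exact hfin
  calc μ {ω | ENNReal.ofReal (Real.sqrt R * (n : ℝ) ^ (-(2 / 5) : ℝ)) <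
        CvxSIM.compDist P (m_est n ω) (θ_est n ω) m₀ θ₀}
      ≤ μ ({ω | n * V ≤ ∑ i ∈ Finset.range n, e i ω ^ 2} ∪ bad) := measure_mono_ae hsub
    _ ≤ ENNReal.ofReal (δ / 2) + ENNReal.ofReal (δ / 2) :=
      (measure_union_le _ _).trans (add_le_add (hnoise n hn) hbad)
    _ = ENNReal.ofReal δ := by
      rw [← ENNReal.ofReal_add (by positivity) (by positivity), add_halves]
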